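/- Let $d\ge 1$ and let $\varphi\in C_c^\infty(\mathbb{R}^d)$ satisfy $0\le\varphi\le 1$, $\varphi=1$ on $[-\tfrac14,\tfrac14]^d$, $\varphi=0$ outside $[-1,1]^d$ and $\sum_{k\in\mathbb{Z}^d}\varphi(\xi-k)=1$ for all $\xi\in\mathbb{R}^d$. Write $\mathscr{F}f(\xi)=\int_{\mathbb{R}^d}f(x)e^{-ix\cdot\xi}\,dx$ for the Fourier transform (extended to tempered distributions), $\langle x\rangle=(1+|x|^2)^{1/2}$, $P_k=\mathscr{F}^{-1}\varphi(\cdot-k)\mathscr{F}$ for $k\in\mathbb{Z}^d$, and $e^{\pm it\langle\nabla\rangle}=\mathscr{F}^{-1}e^{\pm it\langle\xi\rangle}\mathscr{F}$ for $t\in\mathbb{R}$. Then there is a constant $C<\infty$, depending only on $d$ and $\varphi$, such that for all $2\le r\le\infty$ with conjugate exponent $r'$ (so $\tfrac1r+\tfrac1{r'}=1$), both choices of the sign, all $t\in\mathbb{R}$, all $k\in\mathbb{Z}^d$ and all complex-valued $f\in L^{r'}(\mathbb{R}^d)$, the tempered distribution $e^{\pm it\langle\nabla\rangle}P_kf$ belongs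 to $L^r(\mathbb{R}^d)$ and $$\|e^{\pm it\langle\nabla\rangle}P_kf\|_{L^r}\le C\,\min\Big\{1,\ \langle k\rangle^{\frac{d-1}{2}}|t|^{-\frac{d-1}{2}},\ \langle k\rangle^{\frac{d+2}{2}}|t|^{-\frac d2}\Big\}^{1-\frac2r}\,\|f\|_{L^{r'}},$$ where a negative power of $|t|$ is read as $+\infty$ at $t=0$ (so that the minimum is $1$ there). -/

import Mathlib

open MeasureTheory
open scoped ENNReal NNReal SchwartzMap ContDiff

noncomputable section

/-- The Japanese bracket `⟨x⟩ = (1 + |x|²)^{1/2}`. -/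
def japaneseBracket {d : ℕ} (x : EuclideanSpace ℝ (Fin d)) : ℝ :=
  Real.sqrt (1 + ‖x‖ ^ 2)

/-- The lattice point `k ∈ ℤᵈ` as a point of `ℝᵈ`. -/
def latticePoint {d : ℕ} (k : Fin d → ℤ) : EuclideanSpace ℝ (Fin d) :=
  WithLp.toLp 2 (fun i => (k i : ℝ))

/-- The smooth cutoffs whose integer translates define the frequency projections to unit cubes:
`φ ∈ C_c^∞(ℝᵈ)`, `0 ≤ φ ≤ 1`, `φ = 1` on `[-1/4,1/4]ᵈ`, `φ = 0` off `[-1,1]ᵈ`, and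
`∑_{k ∈ ℤᵈ} φ(ξ - k) = 1` for all `ξ`. -/
structure IsUnitCubeCutoff {d : ℕ} (φ : EuclideanSpace ℝ (Fin d) → ℝ) : Prop where
  contDiff : ContDiff ℝ ∞ φ
  nonneg : ∀ ξ, 0 ≤ φ ξ
  le_one : ∀ ξ, φ ξ ≤ 1
  eq_one : ∀ ξ, (∀ i, |ξ i| ≤ 1 / 4) → φ ξ = 1
  eq_zero : ∀ ξ, (∃ i, 1 < |ξ i|) → φ ξ = 0
  hasSum : ∀ ξ, HasSum (fun k : Fin d → ℤ => φ (ξ - latticePoint k)) 1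

/-- The Fourier multiplier `ℱ⁻¹ m ℱ` on tempered distributions for the normalization
`ℱ f(ξ) = ∫ f(x) e^{-i x·ξ} dx`. Mathlib's transform is `𝓕 f(η) = ∫ f(x) e^{-2πi x·η} dx`, that is
`𝓕 f(η) = ℱ f(2πη)`, so the symbol is evaluated at `2πη`. -/
def fourierMultiplier {d : ℕ} (m : EuclideanSpace ℝ (Fin d) → ℂ) :
    𝓢'(EuclideanSpace ℝ (Fin d), ℂ) →L[ℂ] 𝓢'(EuclideanSpace ℝ (Fin d), ℂ) :=
  TemperedDistribution.fourierMultiplierCLM ℂ (fun η => m ((2 * Real.pi) • η))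

/-- The symbol `e^{i s ⟨ξ⟩}`. -/
def kleinGordonSymbol {d : ℕ} (s : ℝ) (ξ : EuclideanSpace ℝ (Fin d)) : ℂ :=
  Complex.exp (Complex.I * ((s * japaneseBracket ξ : ℝ) : ℂ))

/-- The half Klein–Gordon propagator `e^{i s ⟨∇⟩}`. -/
def kleinGordonFlow (d : ℕ) (s : ℝ) :
    𝓢'(EuclideanSpace ℝ (Fin d), ℂ) →L[ℂ] 𝓢'(EuclideanSpace ℝ (Fin d), ℂ) :=
  fourierMultiplier (kleinGordonSymbol s)

/-- The frequency projection `P_k = ℱ⁻¹ φ(· - k) ℱ`. -/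
def cubeProjection {d : ℕ} (φ : EuclideanSpace ℝ (Fin d) → ℝ) (k : Fin d → ℤ) :
    𝓢'(EuclideanSpace ℝ (Fin d), ℂ) →L[ℂ] 𝓢'(EuclideanSpace ℝ (Fin d), ℂ) :=
  fourierMultiplier (fun ξ => (φ (ξ - latticePoint k) : ℂ))

/-- `min {1, ⟨k⟩^{(d-1)/2} |t|^{-(d-1)/2}, ⟨k⟩^{(d+2)/2} |t|^{-d/2}}` in `[0,∞]`; a negative power
of `|t|` is `∞` at `t = 0`. -/
def decayFactor {d : ℕ} (k : Fin d → ℤ) (t : ℝ) : ℝ≥0∞ :=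
  min 1 (min
    (ENNReal.ofReal (japaneseBracket (latticePoint k)) ^ (((d : ℝ) - 1) / 2) *
      ENNReal.ofReal |t| ^ (-(((d : ℝ) - 1) / 2)))
    (ENNReal.ofReal (japaneseBracket (latticePoint k)) ^ (((d : ℝ) + 2) / 2) *
      ENNReal.ofReal |t| ^ (-((d : ℝ) / 2))))

/-! Mathlib multiplies tempered distributions by functions of temperate growth only (other functions
give the value `0`); the two symbols above are of this kind. -/

theorem hasTemperateGrowth_kleinGordonSymbol {d : ℕ} (s : ℝ) :
    (fun η : EuclideanSpace ℝ (Fin d) =>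
      kleinGordonSymbol s ((2 * Real.pi) • η)).HasTemperateGrowth := by
  have h1 : (fun y : ℝ => Complex.exp (Complex.I * (y : ℂ))).HasTemperateGrowth := by
    refine ⟨Complex.contDiff_exp.comp
      (contDiff_const.mul Complex.ofRealCLM.contDiff), fun n => ⟨0, 1, fun x => ?_⟩⟩
    rw [norm_iteratedFDeriv_eq_norm_iteratedDeriv]
    have : ∀ n : ℕ, iteratedDeriv n (fun y : ℝ => Complex.exp (Complex.I * (y : ℂ))) =
        fun y : ℝ => Complex.I ^ n * Complex.exp (Complex.I * (y : ℂ)) := by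
      intro n
      induction n with
      | zero => simp
      | succ n ih =>
        rw [iteratedDeriv_succ, ih]
        ext y
        have h : HasDerivAt (fun y : ℝ => Complex.exp (Complex.I * (y : ℂ)))
            (Complex.exp (Complex.I * (y : ℂ)) * (Complex.I * 1)) y :=
          ((Complex.ofRealCLM.hasDerivAt (x := y)).const_mul Complex.I).cexp
        rw [(h.const_mul (Complex.I ^ n)).deriv]
        ring
    rw [this]
    simp [mul_comm Complex.I, Complex.norm_exp_ofReal_mul_I]
  have h2 : (fun x : EuclideanSpace ℝ (Fin d) =>
      ((1 + ‖x‖ ^ 2) ^ ((1 : ℝ) / 2) : ℝ)).HasTemperateGrowth := by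
    fun_prop
  have h3 : (fun η : EuclideanSpace ℝ (Fin d) => (2 * Real.pi) • η).HasTemperateGrowth := by
    fun_prop
  have h4 : (fun η : EuclideanSpace ℝ (Fin d) =>
      s * (1 + ‖(2 * Real.pi) • η‖ ^ 2) ^ ((1 : ℝ) / 2)).HasTemperateGrowth :=
    (Function.HasTemperateGrowth.const s).mul (h2.comp h3)
  have h5 := h1.comp h4
  simpa only [Function.comp_def, kleinGordonSymbol, japaneseBracket, Real.sqrt_eq_rpow] using h5

theorem IsUnitCubeCutoff.hasTemperateGrowth {d : ℕ} {φ : EuclideanSpace ℝ (Fin d) → ℝ}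
    (hφ : IsUnitCubeCutoff φ) (k : Fin d → ℤ) :
    (fun η : EuclideanSpace ℝ (Fin d) =>
      (φ ((2 * Real.pi) • η - latticePoint k) : ℂ)).HasTemperateGrowth := by
  have hc : HasCompactSupport φ := by
    refine HasCompactSupport.intro
      (K := (EuclideanSpace.equiv (Fin d) ℝ) ⁻¹' (Set.Icc (fun _ => -1) (fun _ => 1))) ?_ ?_
    · exact (EuclideanSpace.equiv (Fin d) ℝ).toHomeomorph.isCompact_preimage.2 isCompact_Icc
    · intro x hx
      apply hφ.eq_zero
      by_contra! h
      exact hx ⟨fun i => (abs_le.1 (h i)).1, fun i => (abs_le.1 (h i)).2⟩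
  have h1 : φ.HasTemperateGrowth := (hc.toSchwartzMap hφ.contDiff).hasTemperateGrowth
  have h3 : (fun η : EuclideanSpace ℝ (Fin d) =>
      (2 * Real.pi) • η - latticePoint k).HasTemperateGrowth := by
    fun_prop
  exact Function.HasTemperateGrowth.comp (g := Complex.ofReal) (by fun_prop) (h1.comp h3)

end

/-! The operator is convolution with a kernel. It is bounded on `L²` because its symbol has modulus
at most 1, and it maps `L¹` to `L^∞` with norm at most the supremum of the kernel. Interpolating
between the two gives the power `1 - 2/r`, so everything rests on the pointwise bound
`exists_enorm_cubeKernel_le`.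

Stationary phase is replaced by an exact formula. For `Re z > 0` the integral `∫ e^{i x·ξ - z⟨ξ⟩}
dξ` is an explicit function of `z` and `w = √(z² + |x|²)` (`bracketExpIntegral_eq`). For real `z`
this comes from writing `e^{-z⟨ξ⟩}` as a superposition of Gaussians and rescaling; complex `z`
follows by analytic continuation. Since `Re w · Im w = Re z · Im z` whatever `x` is, the factor
`e^{-Re w}` compensates for small `|w|`, and a bound uniform in `x` results
(`exists_norm_bracketExpIntegral_le`).

To use it, split `e^{is⟨ξ⟩} φ(ξ - k)` as `e^{-z⟨ξ⟩}` with `z = 1/⟨k⟩ - is`, times the amplitude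
`e^{⟨ξ⟩/⟨k⟩} φ(ξ - k)`. Up to translation the amplitudes form a smooth compactly parametrized
family, so their Fourier transforms are bounded in `L¹` and multiplying by them preserves uniform
bounds (`exists_integral_norm_fourier_le`, `norm_integral_cexp_mul_le`). This gives the `|t|^{-d/2}`
bound. For the `|t|^{-(d-1)/2}` bound, freeze the coordinate where `|k_i|` is largest: the other `d
- 1` variables see a Klein–Gordon phase of mass `m = √(1 + ξ_i²)`, at most a multiple of `⟨k⟩`, and
rescaling by `m` allows `Re z = 1`, without loss.

Interpolation (`integral_norm_rpow_multiplier_le`) applies the three lines theorem to the bilinear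
form of the kernel, tested against powers of `|f|` and of the output itself; for Schwartz `f` all of
these are integrable. Density of Schwartz functions in `L^{r'}` finishes the proof. -/

/-! ### Holomorphic dependence of integrals on a parameter -/

section HolomorphicIntegral

open Filter Topology Metric

/-- A locally dominated integral of holomorphic functions is holomorphic. -/
theorem differentiableOn_integral_of_locally_dominated {α : Type*} [MeasurableSpace α]
    {μ : Measure α} {F : ℂ → α → ℂ} {U : Set ℂ} (hU : IsOpen U)
    (hmeas : ∀ z ∈ U, AEStronglyMeasurable (F z) μ)
    (hdiff : ∀ᵐ a ∂μ, DifferentiableOn ℂ (F · a) U)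
    (hbound : ∀ z₀ ∈ U, ∃ s ∈ 𝓝 z₀, ∃ b : α → ℝ, Integrable b μ ∧
      ∀ᵐ a ∂μ, ∀ z ∈ s, ‖F z a‖ ≤ b a) :
    DifferentiableOn ℂ (fun z => ∫ a, F z a ∂μ) U := by
  intro z₀ hz₀
  obtain ⟨s, hs, b, hb, hFb⟩ := hbound z₀ hz₀
  obtain ⟨r, hr, hrs⟩ := Metric.mem_nhds_iff.1 (inter_mem hs (hU.mem_nhds hz₀))
  have hsub : ∀ z ∈ ball z₀ (r / 2), ball z (r / 2) ⊆ ball z₀ r := by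
    intro z hz
    apply ball_subset_ball'
    rw [mem_ball] at hz
    linarith
  have hr2 : 0 < r / 2 := by positivity
  have hda : ∀ᵐ a ∂μ, ∀ z ∈ ball z₀ r, HasDerivAt (F · a) (deriv (F · a) z) z := by
    filter_upwards [hdiff] with a ha z hz
    exact (ha.differentiableAt (hU.mem_nhds (hrs hz).2)).hasDerivAt
  -- Cauchy's estimate on circles of radius `r / 4` turns the bound `b` for `F` into `b / (r / 4)`
  -- for its derivative.
  have key := hasDerivAt_integral_of_dominated_loc_of_deriv_le (μ := μ) (F := F) (x₀ := z₀)
    (F' := fun z a => deriv (F · a) z) (bound := fun a => b a / (r / 4))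
    (ball_mem_nhds z₀ hr2) ?_ ?_ ?_ ?_ (hb.div_const _) ?_
  · exact key.2.differentiableAt.differentiableWithinAt
  · filter_upwards [hU.mem_nhds hz₀] with z hz using hmeas z hz
  · refine hb.mono' (hmeas z₀ hz₀) ?_
    filter_upwards [hFb] with a ha
    exact ha z₀ (mem_of_mem_nhds hs)
  -- The derivative at `z₀` is measurable in `a` as a limit of difference quotients along a sequence
  -- in `U`.
  · have hlim : Tendsto (fun n : ℕ => z₀ + ((r / 2 / ((n : ℝ) + 1) : ℝ) : ℂ)) atTop (𝓝[≠] z₀) := by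
      have h0 : Tendsto (fun n : ℕ => r / 2 / ((n : ℝ) + 1)) atTop (𝓝 0) :=
        tendsto_const_nhds.div_atTop
          (tendsto_natCast_atTop_atTop.atTop_add tendsto_const_nhds)
      refine tendsto_nhdsWithin_iff.2 ⟨?_, Eventually.of_forall fun n => ?_⟩
      · have := (Complex.continuous_ofReal.tendsto 0).comp h0
        simpa using (tendsto_const_nhds (x := z₀)).add this
      · have : (r / 2 / ((n : ℝ) + 1)) ≠ 0 := by positivity
        rw [Set.mem_compl_singleton_iff, ne_eq, add_eq_left]
        exact_mod_cast this
    refine aestronglyMeasurable_of_tendsto_ae atTop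
      (f := fun (n : ℕ) a => slope (F · a) z₀ (z₀ + ((r / 2 / ((n : ℝ) + 1) : ℝ) : ℂ))) ?_ ?_
    · intro n
      have hmem : z₀ + ((r / 2 / ((n : ℝ) + 1) : ℝ) : ℂ) ∈ U := by
        refine (hrs ?_).2
        rw [mem_ball, dist_eq_norm, add_sub_cancel_left, Complex.norm_real, Real.norm_eq_abs,
          abs_of_pos (by positivity), div_lt_iff₀ (by positivity)]
        nlinarith [(Nat.cast_nonneg n : (0 : ℝ) ≤ n)]
      simp only [slope_def_field]
      simp only [div_eq_mul_inv]
      exact AEStronglyMeasurable.mul_const ((hmeas _ hmem).sub (hmeas _ hz₀)) _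
    · filter_upwards [hda] with a ha
      exact (ha z₀ (mem_ball_self hr)).tendsto_slope.comp hlim
  · filter_upwards [hFb, hdiff] with a ha hd z hz
    refine Complex.norm_deriv_le_of_forall_mem_sphere_norm_le (by positivity) ?_ ?_
    · refine (hd.mono ?_).diffContOnCl
      refine (closure_ball_subset_closedBall.trans
        ((closedBall_subset_ball (by linarith)).trans (hsub z hz))).trans
          (hrs.trans Set.inter_subset_right)
    · intro w hw
      exact ha w (hrs (hsub z hz (sphere_subset_closedBall.trans
        (closedBall_subset_ball (by linarith)) hw))).1
  · filter_upwards [hda] with a ha z hz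
    exact ha z (ball_subset_ball (by linarith) hz)

end HolomorphicIntegral

/-! ### Subordination of `e^{-zs}` to Gaussians -/

section Subordination

open Real Set Filter Topology

theorem hasDerivAt_sqrt_sub_div_sqrt {s q : ℝ} (hq : 0 < q) :
    HasDerivAt (fun q => √q - s / (2 * √q)) ((√q)⁻¹ / 2 + s / (4 * q * √q)) q := by
  have h1 := Real.hasDerivAt_sqrt hq.ne'
  have hsq : √q ≠ 0 := (Real.sqrt_pos.2 hq).ne'
  have h2 := (hasDerivAt_const q s).div (h1.const_mul 2) (by positivity)
  refine (h1.sub h2).congr_deriv ?_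
  have h3 : √q ^ 2 = q := Real.sq_sqrt hq.le
  simp only [mul_pow, h3]
  field_simp
  ring

theorem image_sqrt_sub_div_sqrt {s : ℝ} (hs : 0 < s) :
    (fun q => √q - s / (2 * √q)) '' Ioi 0 = univ := by
  refine eq_univ_of_forall fun u => ?_
  have h1 : 0 < u ^ 2 + 2 * s := by positivity
  have h2 : |u| < √(u ^ 2 + 2 * s) := by
    rw [← Real.sqrt_sq_eq_abs]
    exact Real.sqrt_lt_sqrt (by positivity) (by linarith)
  have h3 : 0 < u + √(u ^ 2 + 2 * s) := by linarith [neg_abs_le u]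
  -- `√q` is the positive root of `X² - uX - s/2`.
  refine ⟨((u + √(u ^ 2 + 2 * s)) / 2) ^ 2, by rw [mem_Ioi]; positivity, ?_⟩
  simp only
  rw [Real.sqrt_sq (by positivity)]
  have h4 := Real.sq_sqrt h1.le
  field_simp
  nlinarith

theorem injOn_sqrt_sub_div_sqrt {s : ℝ} (hs : 0 < s) :
    InjOn (fun q => √q - s / (2 * √q)) (Ioi 0) := by
  refine StrictMonoOn.injOn fun a ha b _ hab => ?_
  rw [mem_Ioi] at ha
  have h0 := Real.sqrt_pos.2 ha
  have h1 := Real.sqrt_lt_sqrt ha.le hab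
  have h2 : s / (2 * √b) ≤ s / (2 * √a) := by gcongr
  change √a - s / (2 * √a) < √b - s / (2 * √b)
  linarith

theorem neg_mul_sqrt_sub_div_sqrt_sq {z s q : ℝ} (hq : 0 < q) :
    -z * (√q - s / (2 * √q)) ^ 2 = z * s + (-z * q - z * s ^ 2 / (4 * q)) := by
  have hsq : √q ≠ 0 := (Real.sqrt_pos.2 hq).ne'
  have h3 : √q ^ 2 = q := Real.sq_sqrt hq.le
  have : (√q - s / (2 * √q)) ^ 2 = √q ^ 2 - s + s ^ 2 / (4 * √q ^ 2) := by
    field_simp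
    ring
  rw [this, h3]
  field_simp
  ring

/-- Up to the factor `e^{zs}` this is the Gaussian `e^{-zu²}` pulled back by `u = √q - s/(2√q)`,
Jacobian included. Both summands of the Jacobian are positive, so each is integrable separately. -/
theorem integrableOn_subordination_aux {z s : ℝ} (hz : 0 < z) (hs : 0 < s) :
    IntegrableOn (fun q => ((√q)⁻¹ / 2 + s / (4 * q * √q)) *
      exp (-z * q - z * s ^ 2 / (4 * q))) (Ioi 0) := by
  have h := (integrableOn_image_iff_integrableOn_abs_deriv_smul measurableSet_Ioi
    (fun q hq => (hasDerivAt_sqrt_sub_div_sqrt (s := s) hq).hasDerivWithinAt)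
    (injOn_sqrt_sub_div_sqrt hs) (fun u => exp (-z * u ^ 2))).1
    (integrable_exp_neg_mul_sq hz).integrableOn
  refine IntegrableOn.congr_fun (h.const_mul (exp (-(z * s)))) (fun q hq => ?_) measurableSet_Ioi
  rw [mem_Ioi] at hq
  have hp := Real.sqrt_pos.2 hq
  simp only [smul_eq_mul]
  rw [neg_mul_sqrt_sub_div_sqrt_sq hq, abs_of_pos (by positivity), exp_add, exp_neg]
  field_simp

theorem integrableOn_subordination {z s : ℝ} (hz : 0 < z) (hs : 0 < s) :
    IntegrableOn (fun q => (√q)⁻¹ * exp (-z * q - z * s ^ 2 / (4 * q))) (Ioi 0) := by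
  refine Integrable.mono' ((integrableOn_subordination_aux hz hs).const_mul 2) ?_ ?_
  · exact Measurable.aestronglyMeasurable (by fun_prop)
  · filter_upwards [ae_restrict_mem measurableSet_Ioi] with q hq
    rw [mem_Ioi] at hq
    have hp := Real.sqrt_pos.2 hq
    rw [Real.norm_of_nonneg (by positivity), ← mul_assoc]
    gcongr
    have : 0 < s / (4 * q * √q) := by positivity
    linarith

theorem integrableOn_subordination' {z s : ℝ} (hz : 0 < z) (hs : 0 < s) :
    IntegrableOn (fun q => s / (4 * q * √q) * exp (-z * q - z * s ^ 2 / (4 * q))) (Ioi 0) := by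
  refine Integrable.mono' (integrableOn_subordination_aux hz hs) ?_ ?_
  · exact Measurable.aestronglyMeasurable (by fun_prop)
  · filter_upwards [ae_restrict_mem measurableSet_Ioi] with q hq
    rw [mem_Ioi] at hq
    have hp := Real.sqrt_pos.2 hq
    rw [Real.norm_of_nonneg (by positivity)]
    gcongr
    have : 0 < (√q)⁻¹ := by positivity
    linarith

/-- The inversion `q ↦ s²/(4q)` swaps the two terms of the exponent and carries one half of the
Jacobian to the other. -/
theorem integral_subordination_reflect {z s : ℝ} (hs : 0 < s) :
    ∫ q in Ioi 0, s / (4 * q * √q) * exp (-z * q - z * s ^ 2 / (4 * q)) =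
      ∫ q in Ioi 0, (√q)⁻¹ / 2 * exp (-z * q - z * s ^ 2 / (4 * q)) := by
  have himg : (fun p : ℝ => s ^ 2 / (4 * p)) '' Ioi 0 = Ioi 0 := by
    apply Subset.antisymm
    · rintro _ ⟨p, hp, rfl⟩
      rw [mem_Ioi] at hp ⊢
      positivity
    · intro q hq
      rw [mem_Ioi] at hq
      refine ⟨s ^ 2 / (4 * q), by rw [mem_Ioi]; positivity, ?_⟩
      field_simp
  have hder : ∀ p ∈ Ioi (0 : ℝ), HasDerivWithinAt (fun p : ℝ => s ^ 2 / (4 * p))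
      (-(s ^ 2 / (4 * p ^ 2))) (Ioi 0) p := by
    intro p hp
    rw [mem_Ioi] at hp
    have h := (hasDerivAt_const p (s ^ 2)).div ((hasDerivAt_id p).const_mul 4) (by simp; positivity)
    refine (h.congr_deriv ?_).hasDerivWithinAt
    simp only [id]
    field_simp
    ring
  have hinj : InjOn (fun p : ℝ => s ^ 2 / (4 * p)) (Ioi 0) := by
    intro a ha b hb hab
    rw [mem_Ioi] at ha hb
    have hab' : s ^ 2 / (4 * a) = s ^ 2 / (4 * b) := hab
    field_simp at hab'
    linarith
  have h := integral_image_eq_integral_abs_deriv_smul measurableSet_Ioi hder hinj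
    (fun q => s / (4 * q * √q) * exp (-z * q - z * s ^ 2 / (4 * q)))
  rw [himg] at h
  rw [h]
  refine setIntegral_congr_fun measurableSet_Ioi fun p hp => ?_
  rw [mem_Ioi] at hp
  have hp' := Real.sqrt_pos.2 hp
  have h3 : √p ^ 2 = p := Real.sq_sqrt hp.le
  have h1 : √(s ^ 2 / (4 * p)) = s / (2 * √p) := by
    rw [Real.sqrt_eq_iff_mul_self_eq (by positivity) (by positivity)]
    field_simp
    rw [h3]
    ring
  simp only [smul_eq_mul]
  rw [abs_neg, abs_of_pos (by positivity), h1]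
  have h2 : -z * (s ^ 2 / (4 * p)) - z * s ^ 2 / (4 * (s ^ 2 / (4 * p))) =
      -z * p - z * s ^ 2 / (4 * p) := by
    field_simp
    ring
  rw [h2, ← mul_assoc]
  congr 1
  field_simp
  linarith

/-- The substitution `u = √q - s/(2√q)` is a bijection from `(0, ∞)` to `ℝ` and turns the Gaussian
integral into two integrals, equal by the reflection above. -/
theorem integral_subordination {z s : ℝ} (hz : 0 < z) (hs : 0 < s) :
    ∫ q in Ioi 0, (√q)⁻¹ * exp (-z * q - z * s ^ 2 / (4 * q)) = √(π / z) * exp (-z * s) := by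
  have h := integral_image_eq_integral_abs_deriv_smul measurableSet_Ioi
    (fun q hq => (hasDerivAt_sqrt_sub_div_sqrt (s := s) hq).hasDerivWithinAt)
    (injOn_sqrt_sub_div_sqrt hs) (fun u => exp (-z * u ^ 2))
  rw [image_sqrt_sub_div_sqrt hs, setIntegral_univ, integral_gaussian] at h
  have h1 : ∫ q in Ioi 0, |(√q)⁻¹ / 2 + s / (4 * q * √q)| •
      exp (-z * (√q - s / (2 * √q)) ^ 2) =
      ∫ q in Ioi 0, exp (z * s) * ((√q)⁻¹ / 2 * exp (-z * q - z * s ^ 2 / (4 * q)) +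
        s / (4 * q * √q) * exp (-z * q - z * s ^ 2 / (4 * q))) := by
    refine setIntegral_congr_fun measurableSet_Ioi fun q hq => ?_
    rw [mem_Ioi] at hq
    have hp := Real.sqrt_pos.2 hq
    simp only [smul_eq_mul]
    rw [neg_mul_sqrt_sub_div_sqrt_sq hq, abs_of_pos (by positivity), exp_add]
    ring
  have hi : IntegrableOn (fun q => (√q)⁻¹ / 2 * exp (-z * q - z * s ^ 2 / (4 * q))) (Ioi 0) := by
    refine ((integrableOn_subordination hz hs).div_const 2).congr (ae_of_all _ fun q => ?_)
    simp only
    ring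
  rw [h1, integral_const_mul, integral_add hi (integrableOn_subordination' hz hs),
    integral_subordination_reflect hs, ← integral_add hi hi] at h
  have h2 : ∫ q in Ioi 0, (√q)⁻¹ * exp (-z * q - z * s ^ 2 / (4 * q)) =
      ∫ q in Ioi 0, ((√q)⁻¹ / 2 * exp (-z * q - z * s ^ 2 / (4 * q)) +
        (√q)⁻¹ / 2 * exp (-z * q - z * s ^ 2 / (4 * q))) := by
    congr 1
    ext q
    ring
  rw [h2, h, neg_mul, exp_neg, mul_right_comm, mul_inv_cancel₀ (exp_pos _).ne', one_mul]

end Subordination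

/-! ### The Fourier transform of `e^{-z⟨ξ⟩}` -/

section BracketExp

open Real Set Filter Topology Complex

variable {n : ℕ}

theorem one_le_japaneseBracket (x : EuclideanSpace ℝ (Fin n)) : 1 ≤ japaneseBracket x :=
  Real.one_le_sqrt.2 (by nlinarith [norm_nonneg x])

theorem japaneseBracket_pos (x : EuclideanSpace ℝ (Fin n)) : 0 < japaneseBracket x :=
  one_pos.trans_le (one_le_japaneseBracket x)

theorem japaneseBracket_sq (x : EuclideanSpace ℝ (Fin n)) : japaneseBracket x ^ 2 = 1 + ‖x‖ ^ 2 :=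
  Real.sq_sqrt (by positivity)

theorem norm_le_japaneseBracket (x : EuclideanSpace ℝ (Fin n)) : ‖x‖ ≤ japaneseBracket x :=
  Real.le_sqrt_of_sq_le (by linarith)

@[fun_prop]
theorem continuous_japaneseBracket : Continuous (japaneseBracket (d := n)) := by
  unfold japaneseBracket
  fun_prop

theorem integrable_exp_neg_mul_japaneseBracket {ε : ℝ} (hε : 0 < ε) :
    Integrable (fun ξ : EuclideanSpace ℝ (Fin n) => Real.exp (-ε * japaneseBracket ξ)) := by
  have hN : ((Module.finrank ℝ (EuclideanSpace ℝ (Fin n)) : ℕ) : ℝ) < ((n + 1 : ℕ) : ℝ) := by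
    simp
  have h := (integrable_one_add_norm
    (μ := (volume : Measure (EuclideanSpace ℝ (Fin n)))) hN).const_mul
      ((n + 1).factorial * (2 / ε) ^ (n + 1))
  refine h.mono' (by fun_prop) (ae_of_all _ fun ξ => ?_)
  have h1 := one_le_japaneseBracket ξ
  have h2 := norm_le_japaneseBracket ξ
  have h3 : 0 ≤ ε * japaneseBracket ξ := by positivity
  have h4 := Real.pow_div_factorial_le_exp (ε * japaneseBracket ξ) h3 (n + 1)
  rw [Real.norm_of_nonneg (Real.exp_nonneg _), neg_mul, Real.exp_neg, Real.rpow_neg (by positivity),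
    Real.rpow_natCast]
  have h5 : 0 < ((n + 1).factorial : ℝ) := by positivity
  have h6 : (ε / 2 * (1 + ‖ξ‖)) ^ (n + 1) ≤ (ε * japaneseBracket ξ) ^ (n + 1) := by
    refine pow_le_pow_left₀ (by positivity) ?_ _
    nlinarith
  calc (Real.exp (ε * japaneseBracket ξ))⁻¹
      ≤ ((ε / 2 * (1 + ‖ξ‖)) ^ (n + 1) / (n + 1).factorial)⁻¹ := by
        gcongr
        exact le_trans (by gcongr) h4
    _ = _ := by
        have h7 : (ε / 2) ^ (n + 1) * (2 / ε) ^ (n + 1) = 1 := by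
          rw [← mul_pow, div_mul_div_cancel₀ two_ne_zero, div_self hε.ne', one_pow]
        rw [mul_pow]
        field_simp
        exact h7.symm

/-- The integral `∫ e^{i x·ξ - z⟨ξ⟩} dξ`. -/
noncomputable def bracketExpIntegral (z : ℂ) (x : EuclideanSpace ℝ (Fin n)) : ℂ :=
  ∫ ξ : EuclideanSpace ℝ (Fin n), cexp (I * (inner ℝ x ξ : ℝ)) * cexp (-z * japaneseBracket ξ)

theorem norm_cexp_I_mul_ofReal (y : ℝ) : ‖cexp (I * y)‖ = 1 := by
  rw [mul_comm, Complex.norm_exp_ofReal_mul_I]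

theorem norm_cexp_neg_mul_japaneseBracket (z : ℂ) (ξ : EuclideanSpace ℝ (Fin n)) :
    ‖cexp (-z * japaneseBracket ξ)‖ = Real.exp (-z.re * japaneseBracket ξ) := by
  rw [Complex.norm_exp]
  simp

theorem differentiableOn_bracketExpIntegral (x : EuclideanSpace ℝ (Fin n)) :
    DifferentiableOn ℂ (fun z => bracketExpIntegral z x) {z | 0 < z.re} := by
  refine differentiableOn_integral_of_locally_dominated (isOpen_lt continuous_const continuous_re)
    (fun z _ => by fun_prop) (ae_of_all _ fun ξ => by fun_prop) fun z₀ hz₀ => ?_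
  rw [mem_ofPred_eq] at hz₀
  refine ⟨{z | z₀.re / 2 < z.re},
    (isOpen_lt continuous_const continuous_re).mem_nhds (by simp [hz₀]), _,
    integrable_exp_neg_mul_japaneseBracket (half_pos hz₀), ae_of_all _ fun ξ z hz => ?_⟩
  rw [mem_ofPred_eq] at hz
  rw [norm_mul, norm_cexp_I_mul_ofReal, one_mul, norm_cexp_neg_mul_japaneseBracket]
  gcongr
  exact (japaneseBracket_pos ξ).le

/-- The subordination formula for `∫ e^{i x·ξ - z⟨ξ⟩} dξ`. -/
theorem bracketExpIntegral_ofReal {z : ℝ} (hz : 0 < z) (x : EuclideanSpace ℝ (Fin n)) :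
    bracketExpIntegral z x = ((√(π / z))⁻¹ * ∫ q in Ioi 0, (√q)⁻¹ *
      Real.exp (-(z + ‖x‖ ^ 2 / z) * q - z / (4 * q)) * (4 * π * (q / z)) ^ ((n : ℝ) / 2) : ℝ) := by
  set F : EuclideanSpace ℝ (Fin n) → ℝ → ℂ := fun ξ q => cexp (I * (inner ℝ x ξ : ℝ)) *
    ((√q)⁻¹ * Real.exp (-z * q - z * (japaneseBracket ξ) ^ 2 / (4 * q)) : ℝ) with hF
  have hnorm : ∀ ξ q, ‖F ξ q‖ =
      (√q)⁻¹ * Real.exp (-z * q - z * (japaneseBracket ξ) ^ 2 / (4 * q)) := by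
    intro ξ q
    rw [hF, norm_mul, norm_cexp_I_mul_ofReal, one_mul, Complex.norm_real,
      Real.norm_of_nonneg (by positivity)]
  have hInt : Integrable (Function.uncurry F)
      ((volume : Measure (EuclideanSpace ℝ (Fin n))).prod (volume.restrict (Ioi (0 : ℝ)))) := by
    rw [integrable_prod_iff]
    · constructor
      · refine ae_of_all _ fun ξ => ?_
        simp only [Function.uncurry_apply_pair, hF]
        exact (integrableOn_subordination hz (japaneseBracket_pos ξ)).ofReal.const_mul _
      -- Taking norms removes only the phase, so the inner integral is again given by the
      -- subordination formula.
      · simp only [Function.uncurry_apply_pair, hnorm]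
        refine ((integrable_exp_neg_mul_japaneseBracket hz).const_mul (√(π / z))).congr
          (ae_of_all _ fun ξ => ?_)
        exact (integral_subordination hz (japaneseBracket_pos ξ)).symm
    · refine Measurable.aestronglyMeasurable ?_
      simp only [hF, Function.uncurry_def]
      have : Continuous (japaneseBracket (d := n)) := continuous_japaneseBracket
      have h1 : Measurable fun p : EuclideanSpace ℝ (Fin n) × ℝ => japaneseBracket p.1 :=
        (this.comp continuous_fst).measurable
      fun_prop
  have hswap := integral_integral_swap hInt
  have hleft : ∀ ξ, ∫ q in Ioi 0, F ξ q =
      √(π / z) * (cexp (I * (inner ℝ x ξ : ℝ)) * cexp (-z * japaneseBracket ξ)) := by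
    intro ξ
    simp only [hF]
    rw [integral_const_mul, integral_complex_ofReal,
      integral_subordination hz (japaneseBracket_pos ξ)]
    push_cast
    ring
  have hright : ∀ q ∈ Ioi (0 : ℝ), ∫ ξ, F ξ q = ((√q)⁻¹ *
      Real.exp (-(z + ‖x‖ ^ 2 / z) * q - z / (4 * q)) * (4 * π * (q / z)) ^ ((n : ℝ) / 2) : ℝ) := by
    intro q hq
    rw [mem_Ioi] at hq
    have hb : 0 < ((z / (4 * q) : ℝ) : ℂ).re := by
      rw [ofReal_re]
      positivity
    have hg := GaussianFourier.integral_cexp_neg_mul_sq_norm_add hb I x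
    have h1 : ∀ ξ, F ξ q = ((√q)⁻¹ * Real.exp (-z * q - z / (4 * q)) : ℝ) *
        cexp (-((z / (4 * q) : ℝ) : ℂ) * ‖ξ‖ ^ 2 + I * (inner ℝ x ξ : ℝ)) := by
      intro ξ
      simp only [hF]
      rw [japaneseBracket_sq]
      have : -z * q - z * (1 + ‖ξ‖ ^ 2) / (4 * q) =
          (-z * q - z / (4 * q)) + -(z / (4 * q)) * ‖ξ‖ ^ 2 := by ring
      rw [this, Real.exp_add, Complex.exp_add]
      push_cast
      ring
    simp only [h1]
    rw [integral_const_mul, hg, finrank_euclideanSpace_fin]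
    have h2 : ((π : ℂ) / ((z / (4 * q) : ℝ) : ℂ)) ^ ((n : ℂ) / 2) =
        (((4 * π * (q / z)) ^ ((n : ℝ) / 2) : ℝ) : ℂ) := by
      rw [Complex.ofReal_cpow (by positivity)]
      push_cast
      congr 1
      field_simp
    have h3 : cexp (I ^ 2 * (‖x‖ : ℂ) ^ 2 / (4 * ((z / (4 * q) : ℝ) : ℂ))) =
        (Real.exp (-(‖x‖ ^ 2 / z * q)) : ℝ) := by
      rw [Complex.ofReal_exp, I_sq]
      push_cast
      congr 1
      field_simp
    have h4 : -(z + ‖x‖ ^ 2 / z) * q - z / (4 * q) =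
      (-z * q - z / (4 * q)) + -(‖x‖ ^ 2 / z * q) := by ring
    rw [h2, h3, h4, Real.exp_add]
    push_cast
    ring
  simp only [hleft] at hswap
  rw [integral_const_mul, setIntegral_congr_fun measurableSet_Ioi hright,
    integral_complex_ofReal] at hswap
  have hne : ((√(π / z) : ℝ) : ℂ) ≠ 0 := by
    rw [Complex.ofReal_ne_zero]
    positivity
  rw [Complex.ofReal_mul, ← hswap, Complex.ofReal_inv, inv_mul_cancel_left₀ hne]
  rfl

/-- Lorentz invariance: `∫ e^{i x·ξ - z⟨ξ⟩} dξ` is determined by its values at `x = 0`. -/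
theorem bracketExpIntegral_eq_zero_right {z : ℝ} (hz : 0 < z) (x : EuclideanSpace ℝ (Fin n)) :
    bracketExpIntegral z x = (z / √(z ^ 2 + ‖x‖ ^ 2) : ℝ) *
      bracketExpIntegral (√(z ^ 2 + ‖x‖ ^ 2) : ℝ) (0 : EuclideanSpace ℝ (Fin n)) := by
  set w := √(z ^ 2 + ‖x‖ ^ 2) with hw
  have hw0 : 0 < w := Real.sqrt_pos.2 (by positivity)
  have hw2 : w ^ 2 = z ^ 2 + ‖x‖ ^ 2 := Real.sq_sqrt (by positivity)
  rw [bracketExpIntegral_ofReal hz, bracketExpIntegral_ofReal hw0, ← Complex.ofReal_mul]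
  congr 1
  have hsub := integral_comp_mul_left_Ioi (fun q => (√q)⁻¹ *
    Real.exp (-(z + ‖x‖ ^ 2 / z) * q - z / (4 * q)) * (4 * π * (q / z)) ^ ((n : ℝ) / 2)) 0
    (show 0 < z / w by positivity)
  rw [mul_zero, smul_eq_mul] at hsub
  have h1 : ∀ p ∈ Ioi (0 : ℝ), (√(z / w * p))⁻¹ *
      Real.exp (-(z + ‖x‖ ^ 2 / z) * (z / w * p) - z / (4 * (z / w * p))) *
        (4 * π * ((z / w * p) / z)) ^ ((n : ℝ) / 2) =
      (√(z / w))⁻¹ * ((√p)⁻¹ * Real.exp (-(w + ‖(0 : EuclideanSpace ℝ (Fin n))‖ ^ 2 / w) * p -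
        w / (4 * p)) * (4 * π * (p / w)) ^ ((n : ℝ) / 2)) := by
    intro p hp
    rw [mem_Ioi] at hp
    have e1 : -(z + ‖x‖ ^ 2 / z) * (z / w * p) - z / (4 * (z / w * p)) =
        -(w + ‖(0 : EuclideanSpace ℝ (Fin n))‖ ^ 2 / w) * p - w / (4 * p) := by
      have : z + ‖x‖ ^ 2 / z = w ^ 2 / z := by
        rw [hw2]
        field_simp
      rw [this, norm_zero]
      field_simp
      ring
    have e2 : (z / w * p) / z = p / w := by field_simp
    rw [e1, e2, Real.sqrt_mul (by positivity), mul_inv]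
    ring
  rw [setIntegral_congr_fun measurableSet_Ioi h1, integral_const_mul] at hsub
  have h2 := (eq_inv_mul_iff_mul_eq₀ (show z / w ≠ 0 by positivity)).1 hsub
  rw [← h2]
  have e3 : (√(π / z))⁻¹ * (z / w * (√(z / w))⁻¹) = z / w * (√(π / w))⁻¹ := by
    have : √(π / w) = √(π / z) * √(z / w) := by
      rw [← Real.sqrt_mul (by positivity)]
      congr 1
      field_simp
    rw [this, mul_inv]
    ring
  rw [← mul_assoc, ← mul_assoc, ← mul_assoc, mul_assoc _ (z / w), e3]

end BracketExp

/-! ### Closed form and uniform decay of `∫ e^{i x·ξ - z⟨ξ⟩} dξ` -/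

section BracketExpDecay

open Real Set Filter Topology Complex

/-- The profile `∫₀^∞ e^{-s} s^{n/2-1} (2 + s/w)^{n/2-1} (1 + s/w) ds`. -/
noncomputable def bracketProfile (n : ℕ) (w : ℂ) : ℂ :=
  ∫ s in Ioi (0 : ℝ), ((Real.exp (-s) * s ^ ((n : ℝ) / 2 - 1) : ℝ) : ℂ) *
    ((2 + s / w) ^ (((n : ℝ) / 2 - 1 : ℝ) : ℂ) * (1 + s / w))

theorem two_le_re_two_add_div {w : ℂ} (hw : 0 < w.re) {s : ℝ} (hs : 0 ≤ s) :
    2 ≤ (2 + (s : ℂ) / w).re := by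
  have h : ((s : ℂ) / w).re = s * w.re / normSq w := by
    rw [Complex.div_re]
    simp
  have h2 : 0 ≤ s * w.re / normSq w := div_nonneg (mul_nonneg hs hw.le) (normSq_nonneg w)
  rw [add_re, h]
  simpa using h2

theorem norm_bracketProfile_integrand_le {n : ℕ} {ρ : ℝ} (hρ : 0 < ρ) {w : ℂ} (hw : 0 < w.re)
    (hρw : ρ ≤ ‖w‖) {s : ℝ} (hs : 0 < s) :
    ‖((Real.exp (-s) * s ^ ((n : ℝ) / 2 - 1) : ℝ) : ℂ) *
      ((2 + s / w) ^ (((n : ℝ) / 2 - 1 : ℝ) : ℂ) * (1 + s / w))‖ ≤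
    Real.exp (-s) * s ^ ((n : ℝ) / 2 - 1) * (2 + s / ρ) ^ (n + 1) := by
  rw [norm_mul, Complex.norm_real, Real.norm_of_nonneg (by positivity)]
  gcongr
  have h2 := two_le_re_two_add_div hw hs.le
  have h3 : 2 ≤ ‖2 + (s : ℂ) / w‖ := h2.trans (re_le_norm _)
  have h4 : ‖(s : ℂ) / w‖ ≤ s / ρ := by
    rw [norm_div, Complex.norm_real, Real.norm_of_nonneg hs.le]
    gcongr
  have h5 : ‖2 + (s : ℂ) / w‖ ≤ 2 + s / ρ := (norm_add_le _ _).trans (by simpa using h4)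
  have h6 : ‖1 + (s : ℂ) / w‖ ≤ 2 + s / ρ := (norm_add_le _ _).trans (by rw [norm_one]; linarith)
  rw [norm_mul, Complex.norm_cpow_real, pow_succ]
  gcongr
  calc ‖2 + (s : ℂ) / w‖ ^ ((n : ℝ) / 2 - 1) ≤ ‖2 + (s : ℂ) / w‖ ^ (n : ℝ) := by
        apply Real.rpow_le_rpow_of_exponent_le (by linarith)
        linarith [(Nat.cast_nonneg n : (0 : ℝ) ≤ n)]
    _ ≤ (2 + s / ρ) ^ n := by
        rw [Real.rpow_natCast]
        gcongr

theorem integrableOn_bracketProfile_bound {n : ℕ} (hn : 1 ≤ n) {ρ : ℝ} (hρ : 0 < ρ) :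
    IntegrableOn (fun s => Real.exp (-s) * s ^ ((n : ℝ) / 2 - 1) * (2 + s / ρ) ^ (n + 1))
      (Ioi 0) := by
  have hn' : (1 : ℝ) ≤ n := by exact_mod_cast hn
  -- Half of the exponential absorbs the polynomial: `2 + s/ρ = (2/ρ)(ρ + s/2)`, and `(ρ + s/2)^N ≤
  -- N! e^{ρ + s/2}`.
  have h := (integrableOn_rpow_mul_exp_neg_mul_rpow (p := 1) (s := (n : ℝ) / 2 - 1) (b := 1 / 2)
    (by linarith) one_pos (by norm_num)).const_mul
      ((n + 1).factorial * (2 / ρ) ^ (n + 1) * Real.exp ρ)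
  refine Integrable.mono' h (by fun_prop) ?_
  filter_upwards [ae_restrict_mem measurableSet_Ioi] with s hs
  rw [mem_Ioi] at hs
  rw [Real.norm_of_nonneg (by positivity), Real.rpow_one]
  have h1 := Real.pow_div_factorial_le_exp (ρ + s / 2) (by positivity) (n + 1)
  have h2 : (2 + s / ρ) ^ (n + 1) = (2 / ρ) ^ (n + 1) * (ρ + s / 2) ^ (n + 1) := by
    rw [← mul_pow]
    congr 1
    field_simp
  have h5 : 0 < ((n + 1).factorial : ℝ) := by positivity
  rw [div_le_iff₀ h5] at h1
  have h6 : Real.exp (-(1 / 2) * s) = Real.exp (-s) * Real.exp (s / 2) := by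
    rw [← Real.exp_add]
    congr 1
    ring
  calc Real.exp (-s) * s ^ ((n : ℝ) / 2 - 1) * (2 + s / ρ) ^ (n + 1)
      ≤ Real.exp (-s) * s ^ ((n : ℝ) / 2 - 1) *
          ((2 / ρ) ^ (n + 1) * (Real.exp (ρ + s / 2) * (n + 1).factorial)) := by
        rw [h2]
        gcongr
    _ = _ := by
        rw [h6, Real.exp_add]
        ring

theorem differentiableOn_bracketProfile {n : ℕ} (hn : 1 ≤ n) :
    DifferentiableOn ℂ (bracketProfile n) {w | 0 < w.re} := by
  refine differentiableOn_integral_of_locally_dominated (isOpen_lt continuous_const continuous_re)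
    (fun w _ => by fun_prop) ?_ fun w₀ hw₀ => ?_
  · filter_upwards [ae_restrict_mem measurableSet_Ioi] with s hs w hw
    have hw' : 0 < w.re := hw
    have hw0 : w ≠ 0 := fun h => by simp [h] at hw'
    have hd : DifferentiableAt ℂ (fun w : ℂ => (s : ℂ) / w) w :=
      (differentiableAt_const _).div differentiableAt_id hw0
    refine DifferentiableAt.differentiableWithinAt ?_
    refine (differentiableAt_const _).mul (DifferentiableAt.mul ?_ (hd.const_add 1))
    refine (hd.const_add 2).cpow (differentiableAt_const _) ?_
    exact Or.inl (by linarith [two_le_re_two_add_div hw' (le_of_lt hs)])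
  · have hw' : 0 < w₀.re := hw₀
    have hw0 : 0 < ‖w₀‖ := norm_pos_iff.2 fun h => by simp [h] at hw'
    refine ⟨{w | 0 < w.re} ∩ {w | ‖w₀‖ / 2 < ‖w‖}, ?_, _,
      integrableOn_bracketProfile_bound hn (half_pos hw0), ?_⟩
    · exact inter_mem ((isOpen_lt continuous_const continuous_re).mem_nhds hw₀)
        ((isOpen_lt continuous_const continuous_norm).mem_nhds (by simpa using hw0))
    · filter_upwards [ae_restrict_mem measurableSet_Ioi] with s hs w hw
      exact norm_bracketProfile_integrand_le (half_pos hw0) hw.1 (le_of_lt hw.2) hs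

theorem exists_norm_bracketProfile_le {n : ℕ} (hn : 1 ≤ n) :
    ∃ C : ℝ, 0 ≤ C ∧ ∀ w : ℂ, 0 < w.re → 1 ≤ ‖w‖ → ‖bracketProfile n w‖ ≤ C := by
  refine ⟨∫ s in Ioi 0, Real.exp (-s) * s ^ ((n : ℝ) / 2 - 1) * (2 + s / 1) ^ (n + 1), ?_,
    fun w hw h1 => ?_⟩
  · refine setIntegral_nonneg measurableSet_Ioi fun s hs => ?_
    rw [mem_Ioi] at hs
    positivity
  · refine norm_integral_le_of_norm_le (integrableOn_bracketProfile_bound hn one_pos) ?_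
    filter_upwards [ae_restrict_mem measurableSet_Ioi] with s hs
    exact norm_bracketProfile_integrand_le one_pos hw h1 hs

/-- Substitute `√(1 + r²) = 1 + s/w`, that is `r² = (s/w)(2 + s/w)`, which makes the exponent linear
in `s`. The resulting profile extends holomorphically to `Re w > 0`. -/
theorem integral_radial_exp_neg_mul_sqrt {n : ℕ} (hn : 1 ≤ n) {w : ℝ} (hw : 0 < w) :
    ∫ r in Ioi (0 : ℝ), r ^ (n - 1) * Real.exp (-w * √(1 + r ^ 2)) =
      Real.exp (-w) * w ^ (-((n : ℝ) / 2)) * ∫ s in Ioi (0 : ℝ),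
        Real.exp (-s) * s ^ ((n : ℝ) / 2 - 1) *
          ((2 + s / w) ^ ((n : ℝ) / 2 - 1) * (1 + s / w)) := by
  have hpos : ∀ s ∈ Ioi (0 : ℝ), 0 < s / w * (2 + s / w) := by
    intro s hs
    rw [mem_Ioi] at hs
    positivity
  have hder : ∀ s ∈ Ioi (0 : ℝ), HasDerivWithinAt (fun s : ℝ => √(s / w * (2 + s / w)))
      ((1 + s / w) / (w * √(s / w * (2 + s / w)))) (Ioi 0) s := by
    intro s hs
    have h1 : HasDerivAt (fun s : ℝ => s / w) (1 / w) s := (hasDerivAt_id s).div_const w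
    have h2 := (h1.mul (h1.const_add 2)).sqrt (hpos s hs).ne'
    refine (h2.congr_deriv ?_).hasDerivWithinAt
    have := Real.sqrt_pos.2 (hpos s hs)
    simp only [Pi.mul_apply]
    field_simp
    ring
  have hinj : InjOn (fun s : ℝ => √(s / w * (2 + s / w))) (Ioi 0) := by
    refine StrictMonoOn.injOn fun a ha b hb hab => ?_
    rw [mem_Ioi] at ha hb
    refine Real.sqrt_lt_sqrt (hpos a ha).le ?_
    have : a / w < b / w := by gcongr
    have h0 : 0 < a / w := by positivity
    nlinarith
  have himg : (fun s : ℝ => √(s / w * (2 + s / w))) '' Ioi 0 = Ioi 0 := by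
    apply Subset.antisymm
    · rintro _ ⟨s, hs, rfl⟩
      exact Real.sqrt_pos.2 (hpos s hs)
    · intro r hr
      rw [mem_Ioi] at hr
      have h1 : 1 < √(1 + r ^ 2) := by
        rw [Real.lt_sqrt one_pos.le]
        nlinarith
      refine ⟨w * (√(1 + r ^ 2) - 1), mul_pos hw (by linarith), ?_⟩
      simp only
      rw [mul_div_cancel_left₀ _ hw.ne']
      have h2 : √(1 + r ^ 2) ^ 2 = 1 + r ^ 2 := Real.sq_sqrt (by positivity)
      rw [Real.sqrt_eq_iff_mul_self_eq (by nlinarith) hr.le]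
      nlinarith
  have h := integral_image_eq_integral_abs_deriv_smul measurableSet_Ioi hder hinj
    (fun r => r ^ (n - 1) * Real.exp (-w * √(1 + r ^ 2)))
  rw [himg] at h
  rw [h, ← integral_const_mul]
  refine setIntegral_congr_fun measurableSet_Ioi fun s hs => ?_
  have hp := hpos s hs
  have hr := Real.sqrt_pos.2 hp
  rw [mem_Ioi] at hs
  simp only [smul_eq_mul]
  rw [abs_of_pos (by positivity), Real.sq_sqrt hp.le]
  have e1 : √(1 + s / w * (2 + s / w)) = 1 + s / w := by
    rw [Real.sqrt_eq_iff_mul_self_eq (by positivity) (by positivity)]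
    ring
  have e2 : √(s / w * (2 + s / w)) ^ (n - 1) / √(s / w * (2 + s / w)) =
      (s / w * (2 + s / w)) ^ ((n : ℝ) / 2 - 1) := by
    rw [Real.sqrt_eq_rpow, ← Real.rpow_natCast, ← Real.rpow_mul hp.le, ← Real.rpow_sub hp,
      Nat.cast_sub hn]
    congr 1
    push_cast
    ring
  have e3 : (s / w * (2 + s / w)) ^ ((n : ℝ) / 2 - 1) =
      s ^ ((n : ℝ) / 2 - 1) * (w * w ^ (-((n : ℝ) / 2))) * (2 + s / w) ^ ((n : ℝ) / 2 - 1) := by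
    rw [Real.mul_rpow (by positivity) (by positivity), Real.div_rpow hs.le hw.le,
      Real.rpow_sub hw, Real.rpow_neg hw.le, Real.rpow_one]
    field_simp
  rw [e1]
  have e4 : -w * (1 + s / w) = -w + -s := by
    field_simp
    ring
  rw [e4, Real.exp_add]
  calc _ = (√(s / w * (2 + s / w)) ^ (n - 1) / √(s / w * (2 + s / w))) * (1 + s / w) / w *
        (Real.exp (-w) * Real.exp (-s)) := by
        field_simp
    _ = _ := by
        rw [e2, e3]
        field_simp

theorem bracketExpIntegral_zero_right {n : ℕ} (hn : 1 ≤ n) {w : ℝ} (hw : 0 < w) :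
    bracketExpIntegral w (0 : EuclideanSpace ℝ (Fin n)) =
      (n * volume.real (Metric.ball (0 : EuclideanSpace ℝ (Fin n)) 1) : ℝ) *
        (cexp (-w) * (w : ℂ) ^ ((-((n : ℝ) / 2) : ℝ) : ℂ) * bracketProfile n w) := by
  have : Nonempty (Fin n) := ⟨⟨0, hn⟩⟩
  have h := integral_fun_norm_addHaar (volume : Measure (EuclideanSpace ℝ (Fin n)))
    (fun r => Real.exp (-w * √(1 + r ^ 2)))
  simp only [smul_eq_mul, nsmul_eq_mul, finrank_euclideanSpace_fin] at h
  rw [integral_radial_exp_neg_mul_sqrt hn hw] at h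
  have h1 : bracketExpIntegral w (0 : EuclideanSpace ℝ (Fin n)) =
      ((∫ x : EuclideanSpace ℝ (Fin n), Real.exp (-w * √(1 + ‖x‖ ^ 2)) : ℝ) : ℂ) := by
    rw [← integral_complex_ofReal]
    unfold bracketExpIntegral japaneseBracket
    simp
  have h2 : bracketProfile n w = ((∫ s in Ioi (0 : ℝ), Real.exp (-s) * s ^ ((n : ℝ) / 2 - 1) *
      ((2 + s / w) ^ ((n : ℝ) / 2 - 1) * (1 + s / w)) : ℝ) : ℂ) := by
    rw [← integral_complex_ofReal]
    refine setIntegral_congr_fun measurableSet_Ioi fun s hs => ?_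
    rw [mem_Ioi] at hs
    rw [Complex.ofReal_mul _ (_ * _), Complex.ofReal_mul (_ ^ _) (_ + _),
      Complex.ofReal_cpow (by positivity)]
    push_cast
    rfl
  rw [h1, h, h2, ← Complex.ofReal_cpow hw.le]
  push_cast
  ring

/-- The principal square root halves the argument, which lies strictly between `-π` and `π`. -/
theorem re_cpow_half_pos {a : ℂ} (ha : a ∈ slitPlane) : 0 < (a ^ (1 / 2 : ℂ)).re := by
  rw [mem_slitPlane_iff_arg] at ha
  rw [Complex.cpow_def_of_ne_zero ha.2, Complex.exp_re]
  refine mul_pos (Real.exp_pos _) (Real.cos_pos_of_mem_Ioo ?_)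
  have h1 : (Complex.log a * (1 / 2 : ℂ)).im = arg a / 2 := by
    rw [show (1 / 2 : ℂ) = ((1 / 2 : ℝ) : ℂ) by push_cast; rfl, Complex.im_mul_ofReal,
      Complex.log_im]
    ring
  have h2 := neg_pi_lt_arg a
  have h3 := lt_of_le_of_ne (arg_le_pi a) ha.1
  rw [h1]
  constructor <;> linarith

theorem cpow_half_sq (a : ℂ) : (a ^ (1 / 2 : ℂ)) ^ 2 = a := by
  simp

/-- `Im(z² + y) = 2 Re z Im z` vanishes only for real `z`, and then `z² + y > 0`. Hence `w = √(z² +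
|x|²)` is holomorphic on the right half plane. -/
theorem sq_add_mem_slitPlane {z : ℂ} (hz : 0 < z.re) {y : ℝ} (hy : 0 ≤ y) :
    z ^ 2 + y ∈ slitPlane := by
  rw [mem_slitPlane_iff]
  by_cases h : z.im = 0
  · left
    simp only [pow_two, add_re, mul_re, h, ofReal_re]
    nlinarith
  · right
    simp only [pow_two, add_im, mul_im, ofReal_im]
    have := mul_ne_zero hz.ne' h
    intro h0
    apply this
    linarith

/-- The closed form of `∫ e^{i x·ξ - z⟨ξ⟩} dξ` on the right half plane. -/
theorem bracketExpIntegral_eq {n : ℕ} (hn : 1 ≤ n) (x : EuclideanSpace ℝ (Fin n)) {z : ℂ}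
    (hz : 0 < z.re) {w : ℂ} (hw : w = (z ^ 2 + (‖x‖ ^ 2 : ℝ)) ^ (1 / 2 : ℂ)) :
    bracketExpIntegral z x = z / w *
      ((n * volume.real (Metric.ball (0 : EuclideanSpace ℝ (Fin n)) 1) : ℝ) *
        (cexp (-w) * w ^ ((-((n : ℝ) / 2) : ℝ) : ℂ) * bracketProfile n w)) := by
  subst hw
  have hU : IsOpen {z : ℂ | 0 < z.re} := isOpen_lt continuous_const continuous_re
  have hd : DifferentiableOn ℂ (fun z : ℂ => (z ^ 2 + (‖x‖ ^ 2 : ℝ)) ^ (1 / 2 : ℂ))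
      {z : ℂ | 0 < z.re} := by
    intro z hz
    exact DifferentiableAt.differentiableWithinAt (DifferentiableAt.cpow (by fun_prop)
      (by fun_prop) (sq_add_mem_slitPlane hz (by positivity)))
  have hmaps : MapsTo (fun z : ℂ => (z ^ 2 + (‖x‖ ^ 2 : ℝ)) ^ (1 / 2 : ℂ))
      {z : ℂ | 0 < z.re} {z : ℂ | 0 < z.re} :=
    fun z hz => re_cpow_half_pos (sq_add_mem_slitPlane hz (by positivity))
  refine AnalyticOnNhd.eqOn_of_preconnected_of_frequently_eq
    (𝕜 := ℂ) (f := fun z => bracketExpIntegral z x)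
    (g := fun z => z / (z ^ 2 + (‖x‖ ^ 2 : ℝ)) ^ (1 / 2 : ℂ) *
      ((n * volume.real (Metric.ball (0 : EuclideanSpace ℝ (Fin n)) 1) : ℝ) *
        (cexp (-((z ^ 2 + (‖x‖ ^ 2 : ℝ)) ^ (1 / 2 : ℂ))) *
          ((z ^ 2 + (‖x‖ ^ 2 : ℝ)) ^ (1 / 2 : ℂ)) ^ ((-((n : ℝ) / 2) : ℝ) : ℂ) *
            bracketProfile n ((z ^ 2 + (‖x‖ ^ 2 : ℝ)) ^ (1 / 2 : ℂ)))))
    (z₀ := 1) (U := {z : ℂ | 0 < z.re})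
    ((differentiableOn_bracketExpIntegral x).analyticOnNhd hU) ?_
    (convex_halfSpace_re_gt 0).isPreconnected (by simp) ?_ hz
  · refine DifferentiableOn.analyticOnNhd ?_ hU
    refine DifferentiableOn.mul (differentiableOn_id.div hd fun z hz h => ?_)
      (DifferentiableOn.const_mul (DifferentiableOn.mul (DifferentiableOn.mul ?_ ?_) ?_) _)
    · have h1 : 0 < ((z ^ 2 + ((‖x‖ ^ 2 : ℝ) : ℂ)) ^ (1 / 2 : ℂ)).re := hmaps hz
      rw [h, zero_re] at h1
      exact h1.false
    · exact hd.neg.cexp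
    · exact hd.cpow (differentiableOn_const _) fun z hz => Or.inl (hmaps hz)
    · exact (differentiableOn_bracketProfile hn).comp hd hmaps
  -- Identity theorem: the real points `1 + 1/(m+1)`, where Lorentz invariance and the radial
  -- computation apply, accumulate at 1.
  · have hlim : Tendsto (fun m : ℕ => ((1 + 1 / ((m : ℝ) + 1) : ℝ) : ℂ)) atTop (𝓝[≠] 1) := by
      refine tendsto_nhdsWithin_iff.2 ⟨?_, Eventually.of_forall fun m => ?_⟩
      · have h0 : Tendsto (fun m : ℕ => 1 + 1 / ((m : ℝ) + 1)) atTop (𝓝 (1 + 0)) :=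
          tendsto_const_nhds.add tendsto_one_div_add_atTop_nhds_zero_nat
        have h1 := (Complex.continuous_ofReal.tendsto (1 + 0)).comp h0
        rwa [add_zero, Complex.ofReal_one] at h1
      · have : (1 / ((m : ℝ) + 1)) ≠ 0 := by positivity
        rw [Set.mem_compl_singleton_iff, ne_eq, Complex.ofReal_eq_one, add_eq_left]
        exact this
    refine hlim.frequently (Frequently.of_forall fun m => ?_)
    have hm : (0 : ℝ) < 1 + 1 / ((m : ℝ) + 1) := by positivity
    generalize (1 + 1 / ((m : ℝ) + 1)) = y at hm
    have hs : ((y : ℂ) ^ 2 + ((‖x‖ ^ 2 : ℝ) : ℂ)) ^ (1 / 2 : ℂ) = (√(y ^ 2 + ‖x‖ ^ 2) : ℝ) := by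
      rw [Real.sqrt_eq_rpow, Complex.ofReal_cpow (by positivity)]
      push_cast
      rfl
    rw [hs, bracketExpIntegral_eq_zero_right hm,
      bracketExpIntegral_zero_right hn (Real.sqrt_pos.2 (by positivity))]
    push_cast
    rfl

theorem exists_rpow_mul_exp_neg_le (p : ℝ) (hp : 0 ≤ p) :
    ∃ C : ℝ, 0 ≤ C ∧ ∀ a : ℝ, 0 ≤ a → a ^ p * Real.exp (-a) ≤ C := by
  refine ⟨p ^ p + ⌈p⌉₊.factorial + 1, by positivity, fun a ha => ?_⟩
  have hN := Nat.le_ceil p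
  have h1 := Real.pow_div_factorial_le_exp a ha ⌈p⌉₊
  have h5 : 0 < ((⌈p⌉₊).factorial : ℝ) := by positivity
  have hpp : 0 ≤ p ^ p := by positivity
  rw [div_le_iff₀ h5] at h1
  rw [Real.exp_neg, ← div_eq_mul_inv, div_le_iff₀ (Real.exp_pos a)]
  rcases le_total a 1 with h | h
  · have h2 : a ^ p ≤ 1 := Real.rpow_le_one ha h hp
    have h3 : 1 ≤ Real.exp a := Real.one_le_exp ha
    nlinarith
  · have h2 : a ^ p ≤ a ^ (⌈p⌉₊ : ℝ) := Real.rpow_le_rpow_of_exponent_le h hN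
    rw [Real.rpow_natCast] at h2
    nlinarith [Real.exp_pos a]

/-- Decay of `∫ e^{i x·ξ - (ε + it)⟨ξ⟩} dξ`, uniformly in `x`. -/
theorem exists_norm_bracketExpIntegral_le {n : ℕ} (hn : 1 ≤ n) :
    ∃ C : ℝ, 0 ≤ C ∧ ∀ (z : ℂ) (x : EuclideanSpace ℝ (Fin n)), 0 < z.re → z.re ≤ 1 →
      1 ≤ |z.im| → 1 ≤ z.re * |z.im| →
      ‖bracketExpIntegral z x‖ ≤
        C * (z.re ^ (-(((n : ℝ) + 2) / 2)) * |z.im| ^ (-((n : ℝ) / 2))) := by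
  obtain ⟨C₁, hC₁, hQ⟩ := exists_norm_bracketProfile_le hn
  obtain ⟨C₂, hC₂, hE⟩ := exists_rpow_mul_exp_neg_le (((n : ℝ) + 2) / 2) (by positivity)
  set V : ℝ := n * volume.real (Metric.ball (0 : EuclideanSpace ℝ (Fin n)) 1) with hV
  have hV0 : 0 ≤ V := by positivity
  refine ⟨2 * (V * (C₂ * C₁)), by positivity, fun z x hz hz1 ht hzt => ?_⟩
  set p : ℝ := ((n : ℝ) + 2) / 2 with hp
  set ε := z.re with hε
  set t := |z.im| with ht'
  set w : ℂ := (z ^ 2 + (‖x‖ ^ 2 : ℝ)) ^ (1 / 2 : ℂ) with hw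
  have hw0 : 0 < w.re := re_cpow_half_pos (sq_add_mem_slitPlane hz (by positivity))
  have hw2 : w ^ 2 = z ^ 2 + (‖x‖ ^ 2 : ℝ) := cpow_half_sq _
  have him : w.re * w.im = ε * z.im := by
    have := congrArg Complex.im hw2
    simp only [pow_two, mul_im, add_im, ofReal_im] at this
    linarith
  have him' : w.re * |w.im| = ε * t := by
    rw [← abs_of_pos hw0, ← abs_mul, him, abs_mul, abs_of_pos hz]
  have hεt : 0 < ε * t := by linarith
  have hnw : ε * t ≤ w.re * ‖w‖ := by
    rw [← him']
    gcongr
    exact abs_im_le_norm w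
  have hw1 : 1 ≤ ‖w‖ := by
    have h1 : w.re * ‖w‖ ≤ ‖w‖ * ‖w‖ := by
      gcongr
      exact re_le_norm w
    nlinarith [norm_nonneg w]
  have hwpos : 0 < ‖w‖ := one_pos.trans_le hw1
  have htpos : 0 < t := one_pos.trans_le ht
  have hznorm : ‖z‖ ≤ 2 * t := by
    have := norm_le_abs_re_add_abs_im z
    rw [abs_of_pos hz] at this
    linarith
  rw [bracketExpIntegral_eq hn x hz hw, norm_mul, norm_mul, norm_mul, norm_mul, norm_div,
    Complex.norm_cpow_real, Complex.norm_exp, Complex.norm_real, Real.norm_of_nonneg hV0, neg_re]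
  -- The factors `1/w` and `w^{-n/2}` combine to the power `-p`. Insert `|w| ≥ εt / Re w` and let
  -- `e^{-Re w}` absorb `(Re w)^p`. The remaining `‖z‖ ≤ 2t` raises the power of `t` from `-p` to `1
  -- - p = -n/2`.
  have hkey : ‖w‖⁻¹ * ‖w‖ ^ (-((n : ℝ) / 2)) * Real.exp (-w.re) ≤ (ε * t) ^ (-p) * C₂ := by
    have h1 : ‖w‖⁻¹ * ‖w‖ ^ (-((n : ℝ) / 2)) = ‖w‖ ^ (-p) := by
      rw [← Real.rpow_neg_one, ← Real.rpow_add hwpos]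
      congr 1
      rw [hp]
      ring
    have h2 : ‖w‖ ^ (-p) ≤ (ε * t) ^ (-p) * w.re ^ p := by
      have : (ε * t / w.re) ≤ ‖w‖ := by
        rw [div_le_iff₀ hw0]
        linarith
      calc ‖w‖ ^ (-p) ≤ (ε * t / w.re) ^ (-p) :=
            Real.rpow_le_rpow_of_nonpos (by positivity) this
              (neg_nonpos.2 (by positivity))
        _ = _ := by
            rw [Real.div_rpow hεt.le hw0.le, Real.rpow_neg hw0.le, div_inv_eq_mul]
    rw [h1]
    calc ‖w‖ ^ (-p) * Real.exp (-w.re) ≤ (ε * t) ^ (-p) * w.re ^ p * Real.exp (-w.re) := by gcongr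
      _ = (ε * t) ^ (-p) * (w.re ^ p * Real.exp (-w.re)) := by ring
      _ ≤ _ := by
          gcongr
          exact hE _ hw0.le
  calc ‖z‖ / ‖w‖ * (V * (Real.exp (-w.re) * ‖w‖ ^ (-((n : ℝ) / 2)) * ‖bracketProfile n w‖))
      = ‖z‖ * (V * ((‖w‖⁻¹ * ‖w‖ ^ (-((n : ℝ) / 2)) * Real.exp (-w.re)) *
          ‖bracketProfile n w‖)) := by
        rw [div_eq_mul_inv]
        ring
    _ ≤ (2 * t) * (V * (((ε * t) ^ (-p) * C₂) * C₁)) := by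
        gcongr
        exact hQ w hw0 hw1
    _ = 2 * (V * (C₂ * C₁)) * (ε ^ (-p) * (t * t ^ (-p))) := by
        rw [Real.mul_rpow hz.le htpos.le]
        ring
    _ = _ := by
        congr 2
        nth_rewrite 1 [← Real.rpow_one t]
        rw [← Real.rpow_add htpos]
        congr 1
        rw [hp]
        ring

end BracketExpDecay

/-! ### Smooth amplitudes have integrable Fourier transforms -/

section Amplitude

open Real Set Filter Topology Complex FourierTransform

variable {E : Type*} [NormedAddCommGroup E] [InnerProductSpace ℝ E] [FiniteDimensional ℝ E]
  [MeasurableSpace E] [BorelSpace E]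

/-- Chain rule along `x ↦ (p, x)`, whose linear part has norm at most 1. It makes joint smoothness
on a compact set give derivative bounds uniform in the parameter. -/
theorem norm_iteratedFDeriv_prodMk_le {P F : Type*} [NormedAddCommGroup P] [NormedSpace ℝ P]
    {V : Type*} [NormedAddCommGroup V] [NormedSpace ℝ V]
    [NormedAddCommGroup F] [NormedSpace ℝ F] {G : P × V → F} {W : Set (P × V)} (hW : IsOpen W)
    (hG : ContDiffOn ℝ ∞ G W) {p : P} (hp : ∀ x, (p, x) ∈ W) (j : ℕ) (x : V) :
    ‖iteratedFDeriv ℝ j (fun x => G (p, x)) x‖ ≤ ‖iteratedFDeriv ℝ j G (p, x)‖ := by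
  set s : Set (P × V) := (fun q => (p, (0 : V)) + q) ⁻¹' W with hs
  have hso : IsOpen s := hW.preimage (by fun_prop)
  have hf : ContDiffOn ℝ ∞ (fun q => G ((p, 0) + q)) s :=
    hG.comp (by fun_prop) (fun q hq => hq)
  have hmem : ∀ y : V, ContinuousLinearMap.inr ℝ P V y ∈ s := fun y => by simpa [hs] using hp y
  have hpre : (ContinuousLinearMap.inr ℝ P V) ⁻¹' s = univ := eq_univ_of_forall hmem
  have h := ContinuousLinearMap.iteratedFDerivWithin_comp_right (ContinuousLinearMap.inr ℝ P V) hf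
    hso.uniqueDiffOn (by rw [hpre]; exact uniqueDiffOn_univ) (hmem x) (i := j)
    (by exact_mod_cast le_top)
  rw [hpre, iteratedFDerivWithin_univ, iteratedFDerivWithin_of_isOpen j hso (hmem x),
    iteratedFDeriv_comp_add_left] at h
  have h1 : (fun q => G ((p, 0) + q)) ∘ (ContinuousLinearMap.inr ℝ P V) = fun x => G (p, x) := by
    ext y
    simp
  rw [h1] at h
  rw [h]
  refine (ContinuousMultilinearMap.norm_compContinuousLinearMap_le _ _).trans ?_
  have h2 : (p, (0 : V)) + ContinuousLinearMap.inr ℝ P V x = (p, x) := by simp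
  rw [h2, Finset.prod_const]
  exact mul_le_of_le_one_right (norm_nonneg _)
    (pow_le_one₀ (norm_nonneg _) (ContinuousLinearMap.norm_inr_le_one ℝ P V))

/-- A smooth family of functions with support in a fixed compact set, with parameters in a compact
set, has Fourier transforms bounded in `L¹`. -/
theorem exists_integral_norm_fourier_le {P : Type*} [NormedAddCommGroup P] [NormedSpace ℝ P]
    {G : P × E → ℂ} {W : Set (P × E)} (hW : IsOpen W) (hG : ContDiffOn ℝ ∞ G W) {Q : Set P}
    (hQ : IsCompact Q) (hQW : ∀ p ∈ Q, ∀ x, (p, x) ∈ W) {K : Set E} (hK : IsCompact K)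
    (hsupp : ∀ p ∈ Q, ∀ x ∉ K, G (p, x) = 0) :
    ∃ C : ℝ, 0 ≤ C ∧ ∀ p ∈ Q, Integrable (𝓕 fun x => G (p, x)) ∧
      ∫ η, ‖𝓕 (fun x => G (p, x)) η‖ ≤ C := by
  have hM : ∀ j : ℕ, ∃ M : ℝ, 0 ≤ M ∧ ∀ p ∈ Q, ∀ x ∈ K, ‖iteratedFDeriv ℝ j G (p, x)‖ ≤ M := by
    intro j
    have hc : ContinuousOn (iteratedFDeriv ℝ j G) (Q ×ˢ K) := fun q hq =>
      ((hG.contDiffAt (hW.mem_nhds (hQW _ hq.1 _))).continuousAt_iteratedFDeriv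
        (k := j) (by exact_mod_cast le_top)).continuousWithinAt
    obtain ⟨M, hM⟩ := (hQ.prod hK).exists_bound_of_continuousOn hc
    exact ⟨max M 0, le_max_right _ _, fun p hp x hx => (hM (p, x) ⟨hp, hx⟩).trans (le_max_left _ _)⟩
  choose M hM0 hM using hM
  -- `N` derivatives yield decay `(1 + ‖η‖)^{-N}`, integrable because `N` exceeds the dimension.
  set N := Module.finrank ℝ E + 1 with hN
  set A : ℝ := volume.real K * M 0 + 2 ^ N * ∑ j ∈ Finset.range (N + 1), volume.real K * M j
    with hA
  have hA0 : 0 ≤ A := by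
    have := Finset.sum_nonneg (s := Finset.range (N + 1)) (f := fun j => volume.real K * M j)
      fun j _ => mul_nonneg measureReal_nonneg (hM0 j)
    have h2 : 0 ≤ volume.real K * M 0 := mul_nonneg measureReal_nonneg (hM0 0)
    positivity
  have hI := (integrable_one_add_norm (μ := (volume : Measure E)) (r := N)
    (by rw [hN]; push_cast; linarith)).const_mul (2 ^ N * A)
  refine ⟨∫ x : E, 2 ^ N * A * (1 + ‖x‖) ^ (-(N : ℝ)),
    integral_nonneg fun x => by positivity, fun p hp => ?_⟩
  set g : E → ℂ := fun x => G (p, x) with hg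
  have hgs : ContDiff ℝ ∞ g := by
    rw [contDiff_iff_contDiffAt]
    intro x
    have h1 : ContDiffAt ℝ ∞ G (p, x) := hG.contDiffAt (hW.mem_nhds (hQW p hp x))
    exact h1.comp x (by fun_prop)
  have hts : tsupport g ⊆ K := by
    refine closure_minimal (fun x hx => ?_) hK.isClosed
    by_contra h
    exact hx (hsupp p hp x h)
  have hcs : HasCompactSupport g := hK.of_isClosed_subset (isClosed_tsupport g) hts
  have hcont : ∀ j : ℕ, Continuous fun x => ‖iteratedFDeriv ℝ j g x‖ := fun j =>
    (hgs.continuous_iteratedFDeriv (by exact_mod_cast le_top)).norm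
  have hInt : ∀ j : ℕ, Integrable fun x => ‖iteratedFDeriv ℝ j g x‖ := fun j =>
    (hcont j).integrable_of_hasCompactSupport (hcs.iteratedFDeriv j).norm
  have hbd : ∀ j : ℕ, ∫ x, ‖iteratedFDeriv ℝ j g x‖ ≤ volume.real K * M j := by
    intro j
    have h1 : ∫ x, ‖iteratedFDeriv ℝ j g x‖ = ∫ x in K, ‖iteratedFDeriv ℝ j g x‖ := by
      refine (setIntegral_eq_integral_of_forall_compl_eq_zero fun x hx => ?_).symm
      rw [norm_eq_zero]
      by_contra h
      exact hx (hts (support_iteratedFDeriv_subset j h))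
    rw [h1]
    calc ∫ x in K, ‖iteratedFDeriv ℝ j g x‖ ≤ ∫ x in K, M j := by
          refine setIntegral_mono_on (hInt j).integrableOn
            (integrableOn_const hK.measure_lt_top.ne) hK.measurableSet fun x hx => ?_
          exact (norm_iteratedFDeriv_prodMk_le hW hG (hQW p hp) j x).trans (hM j p hp x hx)
      _ = volume.real K * M j := by simp
  have hpoint : ∀ w : E, ‖𝓕 g w‖ ≤ 2 ^ N * A * (1 + ‖w‖) ^ (-(N : ℝ)) := by
    intro w
    have h1 : ‖𝓕 g w‖ ≤ volume.real K * M 0 := by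
      refine (VectorFourier.norm_fourierIntegral_le_integral_norm _ _ _ _ _).trans ?_
      refine le_trans (le_of_eq ?_) (hbd 0)
      simp
    have h2 := Real.pow_mul_norm_iteratedFDeriv_fourier_le (K := 0) (N := ⊤) (f := g) hgs
      (fun k n hk _ => by
        have : k = 0 := by simpa using hk
        subst this
        simpa using hInt n) (k := 0) (n := N) le_rfl le_top w
    have h3 : ‖w‖ ^ N * ‖𝓕 g w‖ ≤
        2 ^ N * ∑ j ∈ Finset.range (N + 1), volume.real K * M j := by
      refine le_trans (le_trans (le_of_eq ?_) h2) ?_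
      · simp
      · simp only [pow_zero, one_mul, Nat.cast_zero, mul_zero, zero_add, Finset.range_one,
          Finset.singleton_product, Finset.sum_map, Function.Embedding.coeFn_mk]
        gcongr with j _
        exact hbd j
    have h4 : (1 + ‖w‖) ^ N ≤ 2 ^ N * (1 + ‖w‖ ^ N) := by
      have := add_pow_le (zero_le_one' ℝ) (norm_nonneg w) N
      rw [one_pow] at this
      refine this.trans ?_
      gcongr
      · norm_num
      · omega
    rw [Real.rpow_neg (by positivity), Real.rpow_natCast, ← div_eq_mul_inv,
      le_div_iff₀ (by positivity)]
    calc ‖𝓕 g w‖ * (1 + ‖w‖) ^ N ≤ ‖𝓕 g w‖ * (2 ^ N * (1 + ‖w‖ ^ N)) := by gcongr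
      _ = 2 ^ N * (‖𝓕 g w‖ + ‖w‖ ^ N * ‖𝓕 g w‖) := by ring
      _ ≤ 2 ^ N * A := by
          rw [hA]
          gcongr
  have hFc : Continuous (𝓕 g) :=
    VectorFourier.fourierIntegral_continuous Real.continuous_fourierChar
      (by exact continuous_inner) (hgs.continuous.integrable_of_hasCompactSupport hcs)
  have hFi : Integrable (𝓕 g) := hI.mono' hFc.aestronglyMeasurable (ae_of_all _ hpoint)
  exact ⟨hFi, integral_mono hFi.norm hI hpoint⟩

/-- Multiplication by a function with integrable Fourier transform preserves uniform bounds on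
oscillatory integrals. -/
theorem norm_integral_cexp_mul_le {f g : E → ℂ} {M : ℝ} (hf : Integrable f)
    (hM : ∀ x : E, ‖∫ ξ, cexp (I * (inner ℝ x ξ : ℝ)) * f ξ‖ ≤ M) (hg : Continuous g)
    (hgi : Integrable g) (hg' : Integrable (𝓕 g)) (a x : E) :
    ‖∫ ξ, cexp (I * (inner ℝ x ξ : ℝ)) * (f ξ * g (ξ - a))‖ ≤ M * ∫ η, ‖𝓕 g η‖ := by
  have hinv : ∀ ξ, g (ξ - a) = ∫ η, cexp ((2 * π * inner ℝ η (ξ - a) : ℝ) * I) * 𝓕 g η := by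
    intro ξ
    have h := congrFun (hg.fourierInv_fourier_eq hgi hg') (ξ - a)
    rw [Real.fourierInv_eq'] at h
    exact h.symm
  set F : E → E → ℂ := fun ξ η => cexp (I * (inner ℝ x ξ : ℝ)) *
    cexp ((2 * π * inner ℝ η (ξ - a) : ℝ) * I) * (f ξ * 𝓕 g η) with hF
  have hFint : Integrable (Function.uncurry F) (volume.prod volume) := by
    refine (hf.mul_prod hg').mono ?_ (ae_of_all _ fun q => le_of_eq ?_)
    · refine AEStronglyMeasurable.mul (Continuous.aestronglyMeasurable ?_)
        (hf.mul_prod hg').aestronglyMeasurable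
      fun_prop
    · simp only [Function.uncurry_def, hF]
      rw [norm_mul, norm_mul, norm_cexp_I_mul_ofReal, Complex.norm_exp_ofReal_mul_I]
      simp
  have h1 : ∫ ξ, cexp (I * (inner ℝ x ξ : ℝ)) * (f ξ * g (ξ - a)) = ∫ ξ, ∫ η, F ξ η := by
    congr 1
    ext ξ
    rw [hinv, ← integral_const_mul, ← integral_const_mul]
    congr 1
    ext η
    simp only [hF]
    ring
  -- Each character in the inversion formula for `g` only moves `x` to `x + 2πη`, and the bound `M`
  -- is uniform in `x`.
  have h2 : ∀ η, ∫ ξ, F ξ η = cexp ((-(2 * π * inner ℝ η a) : ℝ) * I) * 𝓕 g η *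
      ∫ ξ, cexp (I * (inner ℝ (x + (2 * π) • η) ξ : ℝ)) * f ξ := by
    intro η
    rw [← integral_const_mul]
    congr 1
    ext ξ
    simp only [hF, inner_add_left, inner_sub_right, inner_smul_left]
    have : cexp (I * (inner ℝ x ξ : ℝ)) *
        cexp ((2 * π * (inner ℝ η ξ - inner ℝ η a) : ℝ) * I) =
        cexp ((-(2 * π * inner ℝ η a) : ℝ) * I) *
          cexp (I * ((inner ℝ x ξ + (starRingEnd ℝ) (2 * π) * inner ℝ η ξ : ℝ) : ℂ)) := by
      rw [← Complex.exp_add, ← Complex.exp_add]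
      congr 1
      simp only [conj_trivial]
      push_cast
      ring
    rw [this]
    ring
  rw [h1, integral_integral_swap hFint]
  simp only [h2]
  rw [← integral_const_mul]
  refine norm_integral_le_of_norm_le (hg'.norm.const_mul M) (ae_of_all _ fun η => ?_)
  rw [norm_mul, norm_mul, Complex.norm_exp_ofReal_mul_I, one_mul, mul_comm]
  gcongr
  exact hM _

end Amplitude

/-! ### Pointwise bounds for the frequency localized kernel -/

section CubeKernel

open Real Set Filter Topology Complex FourierTransform

variable {d : ℕ}

theorem IsUnitCubeCutoff.hasCompactSupport {φ : EuclideanSpace ℝ (Fin d) → ℝ}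
    (hφ : IsUnitCubeCutoff φ) : HasCompactSupport φ := by
  refine HasCompactSupport.intro
    (K := (EuclideanSpace.equiv (Fin d) ℝ) ⁻¹' (Set.Icc (fun _ => -1) (fun _ => 1))) ?_ ?_
  · exact (EuclideanSpace.equiv (Fin d) ℝ).toHomeomorph.isCompact_preimage.2 isCompact_Icc
  · intro x hx
    apply hφ.eq_zero
    by_contra! h
    exact hx ⟨fun i => (abs_le.1 (h i)).1, fun i => (abs_le.1 (h i)).2⟩

theorem IsUnitCubeCutoff.integrable {φ : EuclideanSpace ℝ (Fin d) → ℝ}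
    (hφ : IsUnitCubeCutoff φ) : Integrable φ :=
  hφ.contDiff.continuous.integrable_of_hasCompactSupport hφ.hasCompactSupport

/-- The kernel `∫ e^{i x·ξ} e^{is⟨ξ⟩} φ(ξ - k) dξ`. -/
noncomputable def cubeKernel (φ : EuclideanSpace ℝ (Fin d) → ℝ) (s : ℝ) (k : Fin d → ℤ)
    (x : EuclideanSpace ℝ (Fin d)) : ℂ :=
  ∫ ξ, cexp (I * (inner ℝ x ξ : ℝ)) * (kleinGordonSymbol s ξ * φ (ξ - latticePoint k))

theorem norm_kleinGordonSymbol (s : ℝ) (ξ : EuclideanSpace ℝ (Fin d)) :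
    ‖kleinGordonSymbol s ξ‖ = 1 :=
  norm_cexp_I_mul_ofReal _

@[fun_prop]
theorem continuous_kleinGordonSymbol (s : ℝ) : Continuous (kleinGordonSymbol (d := d) s) := by
  unfold kleinGordonSymbol
  fun_prop

theorem norm_cubeKernel_le {φ : EuclideanSpace ℝ (Fin d) → ℝ} (hφ : IsUnitCubeCutoff φ) (s : ℝ)
    (k : Fin d → ℤ) (x : EuclideanSpace ℝ (Fin d)) : ‖cubeKernel φ s k x‖ ≤ ∫ ξ, φ ξ := by
  rw [← integral_sub_right_eq_self φ (latticePoint k)]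
  refine norm_integral_le_of_norm_le (hφ.integrable.comp_sub_right _) (ae_of_all _ fun ξ => ?_)
  rw [norm_mul, norm_mul, norm_cexp_I_mul_ofReal, norm_kleinGordonSymbol, Complex.norm_real,
    Real.norm_of_nonneg (hφ.nonneg _), one_mul, one_mul]

/-- Damping at rate `1/⟨k⟩` is compensated by `e^{⟨ξ⟩/⟨k⟩}`, whose exponent stays bounded on the
support of `φ(· - k)`. The power `(d+2)/2` of `⟨k⟩` is the price of `Re z = 1/⟨k⟩`. -/
theorem exists_norm_cubeKernel_le_full (hd : 1 ≤ d) {φ : EuclideanSpace ℝ (Fin d) → ℝ}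
    (hφ : IsUnitCubeCutoff φ) :
    ∃ C : ℝ, 0 ≤ C ∧ ∀ (s : ℝ) (k : Fin d → ℤ) (x : EuclideanSpace ℝ (Fin d)),
      japaneseBracket (latticePoint k) ≤ |s| → ‖cubeKernel φ s k x‖ ≤
        C * (japaneseBracket (latticePoint k) ^ (((d : ℝ) + 2) / 2) * |s| ^ (-((d : ℝ) / 2))) := by
  -- At the parameter `(1/κ, k/κ)` the exponent is `⟨ξ + k⟩/κ`. These parameters lie on the compact
  -- sphere `Q`, including its limit points with first entry 0; `W` is where the square root is
  -- smooth.
  set G : (ℝ × EuclideanSpace ℝ (Fin d)) × EuclideanSpace ℝ (Fin d) → ℂ := fun q =>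
    ((φ q.2 * Real.exp (√(q.1.1 ^ 2 + ‖q.1.1 • q.2 + q.1.2‖ ^ 2)) : ℝ) : ℂ) with hG
  set W : Set ((ℝ × EuclideanSpace ℝ (Fin d)) × EuclideanSpace ℝ (Fin d)) :=
    {q | 0 < q.1.1 ^ 2 + ‖q.1.1 • q.2 + q.1.2‖ ^ 2} with hW
  set Q : Set (ℝ × EuclideanSpace ℝ (Fin d)) := {p | p.1 ^ 2 + ‖p.2‖ ^ 2 = 1} with hQ
  have hWo : IsOpen W := isOpen_lt (by fun_prop) (by fun_prop)
  have hGs : ContDiffOn ℝ ∞ G W := by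
    refine Complex.ofRealCLM.contDiff.comp_contDiffOn ?_
    refine (hφ.contDiff.comp contDiff_snd).contDiffOn.mul ?_
    refine Real.contDiff_exp.comp_contDiffOn (ContDiffOn.sqrt ?_ fun q hq => ne_of_gt hq)
    have h1 : ContDiff ℝ ∞ fun q : (ℝ × EuclideanSpace ℝ (Fin d)) × EuclideanSpace ℝ (Fin d) =>
        q.1.1 • q.2 + q.1.2 := by fun_prop
    have h2 : ContDiff ℝ ∞ fun q : (ℝ × EuclideanSpace ℝ (Fin d)) × EuclideanSpace ℝ (Fin d) =>
        q.1.1 ^ 2 := by fun_prop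
    exact (h2.add (h1.norm_sq ℝ)).contDiffOn
  have hQc : IsCompact Q := by
    refine Metric.isCompact_of_isClosed_isBounded (isClosed_eq (by fun_prop) (by fun_prop)) ?_
    refine (Metric.isBounded_iff_subset_closedBall 0).2 ⟨1, fun p hp => ?_⟩
    have hp' : p.1 ^ 2 + ‖p.2‖ ^ 2 = 1 := hp
    rw [mem_closedBall_zero_iff, Prod.norm_def, max_le_iff]
    constructor
    · rw [Real.norm_eq_abs]
      exact abs_le_one_iff_mul_self_le_one.2 (by nlinarith)
    · nlinarith [norm_nonneg p.2]
  have hQW : ∀ p ∈ Q, ∀ x, (p, x) ∈ W := by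
    intro p hp x
    have hp' : p.1 ^ 2 + ‖p.2‖ ^ 2 = 1 := hp
    change 0 < p.1 ^ 2 + ‖p.1 • x + p.2‖ ^ 2
    by_cases h : p.1 = 0
    · simp only [h, zero_smul, zero_add] at hp' ⊢
      linarith
    · positivity
  obtain ⟨C₁, hC₁, hF⟩ := exists_integral_norm_fourier_le hWo hGs hQc hQW hφ.hasCompactSupport
    (fun p _ x hx => by simp [hG, image_eq_zero_of_notMem_tsupport hx])
  obtain ⟨C₂, hC₂, hJ⟩ := exists_norm_bracketExpIntegral_le hd
  refine ⟨C₂ * C₁, by positivity, fun s k x hs => ?_⟩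
  set κ := japaneseBracket (latticePoint k) with hκ
  have hκ1 : 1 ≤ κ := one_le_japaneseBracket _
  have hκ0 : 0 < κ := japaneseBracket_pos _
  -- The hypothesis `κ ≤ |s|` is exactly the condition `1 ≤ Re z · |Im z|` of the decay estimate.
  set z : ℂ := ((κ⁻¹ : ℝ) : ℂ) - I * s with hz
  have hzre : z.re = κ⁻¹ := by simp [hz]
  have hzim : |z.im| = |s| := by simp [hz]
  have hpQ : (κ⁻¹, κ⁻¹ • latticePoint k) ∈ Q := by
    change κ⁻¹ ^ 2 + ‖κ⁻¹ • latticePoint k‖ ^ 2 = 1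
    rw [norm_smul, mul_pow, Real.norm_of_nonneg (by positivity), ← mul_one_add,
      ← japaneseBracket_sq, ← hκ, ← mul_pow, inv_mul_cancel₀ hκ0.ne', one_pow]
  obtain ⟨hFi, hFC⟩ := hF _ hpQ
  set g : EuclideanSpace ℝ (Fin d) → ℂ := fun ξ => G ((κ⁻¹, κ⁻¹ • latticePoint k), ξ) with hg
  have hgc : Continuous g := by
    have := hφ.contDiff.continuous
    simp only [hg, hG]
    fun_prop
  have hgs : HasCompactSupport g :=
    hφ.hasCompactSupport.mono' fun ξ hξ => by
      by_contra h
      exact hξ (by simp [hg, hG, image_eq_zero_of_notMem_tsupport h])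
  have hfi : Integrable fun ξ : EuclideanSpace ℝ (Fin d) => cexp (-z * japaneseBracket ξ) := by
    refine (integrable_exp_neg_mul_japaneseBracket (n := d) (inv_pos.2 hκ0)).mono' (by fun_prop)
      (ae_of_all _ fun ξ => ?_)
    rw [norm_cexp_neg_mul_japaneseBracket, hzre]
  have hM : ∀ y : EuclideanSpace ℝ (Fin d),
      ‖∫ ξ, cexp (I * (inner ℝ y ξ : ℝ)) * cexp (-z * japaneseBracket ξ)‖ ≤
        C₂ * (κ ^ (((d : ℝ) + 2) / 2) * |s| ^ (-((d : ℝ) / 2))) := by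
    intro y
    have h := hJ z y (by rw [hzre]; positivity) (by rw [hzre]; exact inv_le_one_of_one_le₀ hκ1)
      (by rw [hzim]; linarith) (by rw [hzre, hzim, inv_mul_eq_div, one_le_div hκ0]; exact hs)
    rw [hzre, hzim, Real.inv_rpow hκ0.le, ← Real.rpow_neg hκ0.le, neg_neg] at h
    exact h
  have hmain := norm_integral_cexp_mul_le hfi hM hgc (hgc.integrable_of_hasCompactSupport hgs) hFi
    (latticePoint k) x
  have heq : cubeKernel φ s k x = ∫ ξ, cexp (I * (inner ℝ x ξ : ℝ)) *
      (cexp (-z * japaneseBracket ξ) * g (ξ - latticePoint k)) := by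
    unfold cubeKernel
    congr 1
    ext ξ
    congr 1
    have h1 : √(κ⁻¹ ^ 2 + ‖κ⁻¹ • (ξ - latticePoint k) + κ⁻¹ • latticePoint k‖ ^ 2) =
        κ⁻¹ * japaneseBracket ξ := by
      rw [← smul_add, sub_add_cancel, norm_smul, mul_pow, Real.norm_of_nonneg (by positivity),
        ← mul_one_add, ← japaneseBracket_sq, ← mul_pow, Real.sqrt_sq]
      have := japaneseBracket_pos ξ
      positivity
    simp only [hg, hG, h1, kleinGordonSymbol]
    rw [Complex.ofReal_mul (φ _), mul_left_comm, Complex.ofReal_exp, ← Complex.exp_add, mul_comm]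
    congr 2
    rw [hz]
    push_cast
    ring
  rw [heq]
  refine hmain.trans ?_
  rw [mul_right_comm]
  gcongr

end CubeKernel

/-! ### Slices with one frozen frequency coordinate -/

section Slicing

open Real Set Filter Topology Complex FourierTransform

variable {n : ℕ}

/-- The point of `ℝⁿ⁺¹` with `i`-th coordinate `ρ` and the coordinates of `w` elsewhere. -/
noncomputable def insertCoord (i : Fin (n + 1)) (ρ : ℝ) (w : EuclideanSpace ℝ (Fin n)) :
    EuclideanSpace ℝ (Fin (n + 1)) :=
  WithLp.toLp 2 (i.insertNth ρ (fun j => w j))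

/-- The point of `ℝⁿ` obtained by removing the `i`-th coordinate. -/
noncomputable def removeCoord (i : Fin (n + 1)) (x : EuclideanSpace ℝ (Fin (n + 1))) :
    EuclideanSpace ℝ (Fin n) :=
  WithLp.toLp 2 (fun j => x (i.succAbove j))

@[simp]
theorem insertCoord_apply_same (i : Fin (n + 1)) (ρ : ℝ) (w : EuclideanSpace ℝ (Fin n)) :
    insertCoord i ρ w i = ρ := by
  simp [insertCoord]

@[simp]
theorem insertCoord_apply_succAbove (i : Fin (n + 1)) (ρ : ℝ) (w : EuclideanSpace ℝ (Fin n))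
    (j : Fin n) : insertCoord i ρ w (i.succAbove j) = w j := by
  simp [insertCoord]

theorem norm_sq_insertCoord (i : Fin (n + 1)) (ρ : ℝ) (w : EuclideanSpace ℝ (Fin n)) :
    ‖insertCoord i ρ w‖ ^ 2 = ρ ^ 2 + ‖w‖ ^ 2 := by
  rw [EuclideanSpace.norm_sq_eq, EuclideanSpace.norm_sq_eq, Fin.sum_univ_succAbove _ i]
  simp

theorem inner_insertCoord (i : Fin (n + 1)) (x : EuclideanSpace ℝ (Fin (n + 1))) (ρ : ℝ)
    (w : EuclideanSpace ℝ (Fin n)) :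
    inner ℝ x (insertCoord i ρ w) = x i * ρ + inner ℝ (removeCoord i x) w := by
  rw [PiLp.inner_apply, PiLp.inner_apply, Fin.sum_univ_succAbove _ i]
  simp [removeCoord, mul_comm]

theorem insertCoord_sub (i : Fin (n + 1)) (ρ : ℝ) (w : EuclideanSpace ℝ (Fin n))
    (x : EuclideanSpace ℝ (Fin (n + 1))) :
    insertCoord i ρ w - x = insertCoord i (ρ - x i) (w - removeCoord i x) := by
  ext j
  refine i.succAboveCases ?_ (fun j => ?_) j <;> simp [removeCoord]

theorem contDiff_insertCoord (i : Fin (n + 1)) :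
    ContDiff ℝ ∞ fun q : ℝ × EuclideanSpace ℝ (Fin n) => insertCoord i q.1 q.2 := by
  rw [contDiff_euclidean]
  intro j
  refine i.succAboveCases ?_ (fun j => ?_) j
  · simp only [insertCoord_apply_same]
    fun_prop
  · simp only [insertCoord_apply_succAbove]
    fun_prop

theorem measurePreserving_insertCoord (i : Fin (n + 1)) :
    MeasurePreserving (fun q : ℝ × EuclideanSpace ℝ (Fin n) => insertCoord i q.1 q.2) := by
  have h1 : MeasurePreserving (fun q : ℝ × EuclideanSpace ℝ (Fin n) => (q.1, WithLp.ofLp q.2))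
      (volume.prod volume) (volume.prod volume) :=
    (MeasurePreserving.id volume).prod (PiLp.volume_preserving_ofLp (Fin n))
  have h2 := (volume_preserving_piFinSuccAbove (fun _ : Fin (n + 1) => ℝ) i).symm
  exact (PiLp.volume_preserving_toLp (Fin (n + 1))).comp (h2.comp h1)

theorem measurableEmbedding_insertCoord (i : Fin (n + 1)) :
    MeasurableEmbedding (fun q : ℝ × EuclideanSpace ℝ (Fin n) => insertCoord i q.1 q.2) := by
  refine (contDiff_insertCoord i).continuous.measurableEmbedding fun p q hpq => ?_
  have h := fun j => congrFun (congrArg WithLp.ofLp hpq) j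
  refine Prod.ext (by simpa using h i) ?_
  ext j
  simpa using h (i.succAbove j)

theorem integral_eq_integral_insertCoord (i : Fin (n + 1))
    {F : EuclideanSpace ℝ (Fin (n + 1)) → ℂ} (hF : Integrable F) :
    ∫ ξ, F ξ = ∫ ρ : ℝ, ∫ w : EuclideanSpace ℝ (Fin n), F (insertCoord i ρ w) := by
  rw [← (measurePreserving_insertCoord i).integral_comp (measurableEmbedding_insertCoord i)]
  refine integral_prod _ ?_
  exact ((measurePreserving_insertCoord i).integrable_comp_emb
    (measurableEmbedding_insertCoord i)).2 hF

/-- The bound for a single slice `{ξ_i = ρ}`. -/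
theorem exists_norm_integral_slice_le (hn : 1 ≤ n) (i : Fin (n + 1))
    {φ : EuclideanSpace ℝ (Fin (n + 1)) → ℝ} (hφ : IsUnitCubeCutoff φ) (R : ℝ) :
    ∃ C : ℝ, 0 ≤ C ∧ ∀ (s ρ m : ℝ) (a y : EuclideanSpace ℝ (Fin n)), |ρ| ≤ 1 → 1 ≤ m → 1 ≤ |s| →
      ‖a‖ ≤ R * m →
      ‖∫ w, cexp (I * (inner ℝ y w : ℝ)) * (cexp (I * (s * √(m ^ 2 + ‖w‖ ^ 2) : ℝ)) *
        φ (insertCoord i ρ (w - a)))‖ ≤ C * (m / |s|) ^ ((n : ℝ) / 2) := by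
  -- The parameter will be `(ρ, 1/m, a/m)`; `m ≥ 1` and `‖a‖ ≤ R m` keep it in the compact set `Q`.
  set G : (ℝ × ℝ × EuclideanSpace ℝ (Fin n)) × EuclideanSpace ℝ (Fin n) → ℂ := fun q =>
    ((φ (insertCoord i q.1.1 q.2) *
      Real.exp (√(1 + ‖q.1.2.1 • q.2 + q.1.2.2‖ ^ 2)) : ℝ) : ℂ) with hG
  set Q : Set (ℝ × ℝ × EuclideanSpace ℝ (Fin n)) :=
    Icc (-1) 1 ×ˢ Icc 0 1 ×ˢ Metric.closedBall 0 R with hQ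
  have hGs : ContDiff ℝ ∞ G := by
    refine Complex.ofRealCLM.contDiff.comp ?_
    have h0 : ContDiff ℝ ∞ fun q : (ℝ × ℝ × EuclideanSpace ℝ (Fin n)) × EuclideanSpace ℝ (Fin n) =>
        insertCoord i q.1.1 q.2 :=
      (contDiff_insertCoord i).comp (contDiff_fst.fst.prodMk contDiff_snd)
    refine (hφ.contDiff.comp h0).mul (Real.contDiff_exp.comp ?_)
    have h1 : ContDiff ℝ ∞ fun q : (ℝ × ℝ × EuclideanSpace ℝ (Fin n)) × EuclideanSpace ℝ (Fin n) =>
        q.1.2.1 • q.2 + q.1.2.2 := by fun_prop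
    exact (contDiff_const.add (h1.norm_sq ℝ)).sqrt fun q => by positivity
  have hQc : IsCompact Q :=
    isCompact_Icc.prod (isCompact_Icc.prod (isCompact_closedBall 0 R))
  set K : Set (EuclideanSpace ℝ (Fin n)) :=
    (EuclideanSpace.equiv (Fin n) ℝ) ⁻¹' (Set.Icc (fun _ => -1) (fun _ => 1)) with hK
  have hKc : IsCompact K :=
    (EuclideanSpace.equiv (Fin n) ℝ).toHomeomorph.isCompact_preimage.2 isCompact_Icc
  have hφ0 : ∀ ρ, ∀ w ∉ K, φ (insertCoord i ρ w) = 0 := by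
    intro ρ w hw
    refine hφ.eq_zero _ ?_
    by_contra! h
    refine hw ⟨fun j => ?_, fun j => ?_⟩
    · have := h (i.succAbove j)
      rw [insertCoord_apply_succAbove] at this
      exact (abs_le.1 this).1
    · have := h (i.succAbove j)
      rw [insertCoord_apply_succAbove] at this
      exact (abs_le.1 this).2
  obtain ⟨C₁, hC₁, hF⟩ := exists_integral_norm_fourier_le isOpen_univ hGs.contDiffOn hQc
    (fun _ _ _ => mem_univ _) hKc (fun p _ w hw => by simp [hG, hφ0 p.1 w hw])
  obtain ⟨C₂, hC₂, hJ⟩ := exists_norm_bracketExpIntegral_le hn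
  refine ⟨C₂ * C₁, by positivity, fun s ρ m a y hρ hm hs ha => ?_⟩
  have hm0 : 0 < m := one_pos.trans_le hm
  have hs0 : 0 < |s| := one_pos.trans_le hs
  have hpQ : (ρ, m⁻¹, m⁻¹ • a) ∈ Q := by
    refine ⟨abs_le.1 hρ, ⟨by positivity, inv_le_one_of_one_le₀ hm⟩, ?_⟩
    rw [mem_closedBall_zero_iff, norm_smul, Real.norm_of_nonneg (by positivity),
      inv_mul_le_iff₀ hm0, mul_comm]
    exact ha
  obtain ⟨hFi, hFC⟩ := hF _ hpQ
  set g : EuclideanSpace ℝ (Fin n) → ℂ := fun w => G ((ρ, m⁻¹, m⁻¹ • a), w) with hg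
  have hgc : Continuous g := hGs.continuous.comp (by fun_prop)
  have hgs : HasCompactSupport g :=
    HasCompactSupport.intro hKc fun w hw => by simp [hg, hG, hφ0 ρ w hw]
  -- After `w = m u` the phase is `s m ⟨u⟩`, so damping at unit rate suffices. The decay `(|s|
  -- m)^{-n/2}` times the Jacobian `m^n` gives `(m/|s|)^{n/2}`.
  set z : ℂ := 1 - I * (s * m : ℝ) with hz
  have hzre : z.re = 1 := by simp [hz]
  have hzim : |z.im| = |s| * m := by simp [hz, abs_mul, abs_of_pos hm0]
  set f : EuclideanSpace ℝ (Fin n) → ℂ := fun w => cexp (-z * japaneseBracket (m⁻¹ • w)) with hf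
  have hfi : Integrable f := by
    have h0 : Integrable fun u : EuclideanSpace ℝ (Fin n) => cexp (-z * japaneseBracket u) := by
      refine (integrable_exp_neg_mul_japaneseBracket (n := n) one_pos).mono' (by fun_prop)
        (ae_of_all _ fun ξ => ?_)
      rw [norm_cexp_neg_mul_japaneseBracket, hzre]
    exact h0.comp_smul (inv_ne_zero hm0.ne')
  have hM : ∀ v : EuclideanSpace ℝ (Fin n),
      ‖∫ w, cexp (I * (inner ℝ v w : ℝ)) * f w‖ ≤ C₂ * (m / |s|) ^ ((n : ℝ) / 2) := by
    intro v
    have h1 : ∫ w, cexp (I * (inner ℝ v w : ℝ)) * f w =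
        (m ^ n : ℝ) • bracketExpIntegral z (m • v) := by
      have h := Measure.integral_comp_inv_smul (volume : Measure (EuclideanSpace ℝ (Fin n)))
        (fun u => cexp (I * (inner ℝ (m • v) u : ℝ)) * cexp (-z * japaneseBracket u)) m
      rw [finrank_euclideanSpace_fin, abs_of_pos (by positivity)] at h
      rw [bracketExpIntegral, ← h]
      congr 1
      ext w
      simp only [hf, inner_smul_left, inner_smul_right, conj_trivial, inv_mul_cancel_left₀ hm0.ne']
    have h2 := hJ z (m • v) (by rw [hzre]; exact one_pos) hzre.le (by rw [hzim]; nlinarith)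
      (by rw [hzim, hzre]; nlinarith)
    rw [hzre, hzim, Real.one_rpow, one_mul] at h2
    rw [h1, norm_smul, Real.norm_of_nonneg (by positivity)]
    calc m ^ n * ‖bracketExpIntegral z (m • v)‖
        ≤ m ^ n * (C₂ * (|s| * m) ^ (-((n : ℝ) / 2))) := by gcongr
      _ = C₂ * (m / |s|) ^ ((n : ℝ) / 2) := by
        rw [Real.mul_rpow hs0.le hm0.le, Real.div_rpow hm0.le hs0.le, Real.rpow_neg hs0.le]
        have : m ^ n * m ^ (-((n : ℝ) / 2)) = m ^ ((n : ℝ) / 2) := by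
          rw [← Real.rpow_natCast, ← Real.rpow_add hm0]
          congr 1
          ring
        rw [← this]
        ring
  have hmain := norm_integral_cexp_mul_le hfi hM hgc (hgc.integrable_of_hasCompactSupport hgs) hFi
    a y
  have heq : ∀ w, cexp (I * (s * √(m ^ 2 + ‖w‖ ^ 2) : ℝ)) * φ (insertCoord i ρ (w - a)) =
      f w * g (w - a) := by
    intro w
    have h1 : √(1 + ‖m⁻¹ • (w - a) + m⁻¹ • a‖ ^ 2) = japaneseBracket (m⁻¹ • w) := by
      rw [← smul_add, sub_add_cancel]
      rfl
    have h2 : √(m ^ 2 + ‖w‖ ^ 2) = m * japaneseBracket (m⁻¹ • w) := by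
      rw [Real.sqrt_eq_iff_mul_self_eq (by positivity)
        (mul_nonneg hm0.le (japaneseBracket_pos _).le), ← pow_two, mul_pow, japaneseBracket_sq,
        norm_smul, Real.norm_of_nonneg (by positivity)]
      field_simp
    simp only [hf, hg, hG, h1, h2]
    rw [Complex.ofReal_mul (φ _), mul_left_comm (cexp _), Complex.ofReal_exp,
      ← Complex.exp_add, mul_comm]
    congr 2
    rw [hz]
    push_cast
    ring
  simp only [heq]
  refine hmain.trans ?_
  rw [mul_right_comm]
  gcongr

end Slicing

/-! ### The three kernel bounds combined -/

section KernelDecay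

open Real Set Filter Topology Complex FourierTransform

theorem integrable_cubeKernel_integrand {d : ℕ} {φ : EuclideanSpace ℝ (Fin d) → ℝ}
    (hφ : IsUnitCubeCutoff φ) (s : ℝ) (k : Fin d → ℤ) (x : EuclideanSpace ℝ (Fin d)) :
    Integrable fun ξ => cexp (I * (inner ℝ x ξ : ℝ)) *
      (kleinGordonSymbol s ξ * φ (ξ - latticePoint k)) := by
  have hc := hφ.contDiff.continuous
  refine (hφ.integrable.comp_sub_right (latticePoint k)).mono' (by fun_prop)
    (ae_of_all _ fun ξ => ?_)
  rw [norm_mul, norm_mul, norm_cexp_I_mul_ofReal, norm_kleinGordonSymbol, Complex.norm_real,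
    Real.norm_of_nonneg (hφ.nonneg _), one_mul, one_mul]

/-- Integrate the slice bound over the frozen coordinate, which ranges over an interval of length 2.
Freezing the largest coordinate of `k` makes the mass dominate the centre of the slice. -/
theorem exists_norm_cubeKernel_le_slice {n : ℕ} (hn : 1 ≤ n)
    {φ : EuclideanSpace ℝ (Fin (n + 1)) → ℝ} (hφ : IsUnitCubeCutoff φ) :
    ∃ C : ℝ, 0 ≤ C ∧ ∀ (s : ℝ) (k : Fin (n + 1) → ℤ) (x : EuclideanSpace ℝ (Fin (n + 1))),
      japaneseBracket (latticePoint k) ≤ |s| → ‖cubeKernel φ s k x‖ ≤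
        C * (japaneseBracket (latticePoint k) / |s|) ^ ((n : ℝ) / 2) := by
  -- `R = 2n` because the other coordinates of `k` have norm at most `n|k_i| ≤ 2nm`. The index `i`
  -- depends on `k`, hence the sum of the constants below.
  choose C hC0 hC using fun i => exists_norm_integral_slice_le hn i hφ (2 * n)
  refine ⟨2 * ((∑ i, C i) * 3 ^ ((n : ℝ) / 2)), ?_, fun s k x hs => ?_⟩
  · have := Finset.sum_nonneg (s := Finset.univ) fun i _ => hC0 i
    positivity
  set κ := japaneseBracket (latticePoint k) with hκ
  have hκ1 : 1 ≤ κ := one_le_japaneseBracket _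
  have hs0 : 0 < |s| := by linarith
  obtain ⟨i, -, hi⟩ := Finset.exists_max_image Finset.univ (fun j => |(k j : ℝ)|)
    Finset.univ_nonempty
  have hki : |(k i : ℝ)| ≤ κ := by
    refine le_trans ?_ (norm_le_japaneseBracket (latticePoint k))
    exact PiLp.norm_apply_le (latticePoint k) i
  have hrem : ‖removeCoord i (latticePoint k)‖ ≤ n * |(k i : ℝ)| := by
    have h1 : ‖removeCoord i (latticePoint k)‖ ^ 2 ≤ (n * |(k i : ℝ)|) ^ 2 := by
      rw [EuclideanSpace.norm_sq_eq]
      calc ∑ j, ‖removeCoord i (latticePoint k) j‖ ^ 2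
          ≤ ∑ _j : Fin n, |(k i : ℝ)| ^ 2 := by
            refine Finset.sum_le_sum fun j _ => ?_
            exact pow_le_pow_left₀ (norm_nonneg _) (hi (i.succAbove j) (Finset.mem_univ _)) 2
        _ = n * |(k i : ℝ)| ^ 2 := by simp
        _ ≤ (n * |(k i : ℝ)|) ^ 2 := by
            rw [mul_pow]
            gcongr
            have : (1 : ℝ) ≤ n := by exact_mod_cast hn
            nlinarith
    exact le_of_sq_le_sq h1 (by positivity)
  set B : ℝ := C i * (3 * κ / |s|) ^ ((n : ℝ) / 2) with hB
  have hB0 : 0 ≤ B := mul_nonneg (hC0 i) (by positivity)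
  set H : ℝ → ℂ := fun ρ => ∫ w : EuclideanSpace ℝ (Fin n),
    cexp (I * (inner ℝ x (insertCoord i ρ w) : ℝ)) * (kleinGordonSymbol s (insertCoord i ρ w) *
      φ (insertCoord i ρ w - latticePoint k)) with hH
  have hK : cubeKernel φ s k x = ∫ ρ, H ρ :=
    integral_eq_integral_insertCoord i (integrable_cubeKernel_integrand hφ s k x)
  have hout : ∀ ρ, ρ ∉ Icc ((k i : ℝ) - 1) (k i + 1) → H ρ = 0 := by
    intro ρ hρ
    have h0 : ∀ w, φ (insertCoord i ρ w - latticePoint k) = 0 := by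
      intro w
      refine hφ.eq_zero _ ⟨i, ?_⟩
      rw [insertCoord_sub, insertCoord_apply_same]
      by_contra! h
      apply hρ
      have h' : |ρ - (k i : ℝ)| ≤ 1 := h
      rw [abs_le] at h'
      constructor <;> linarith
    simp [hH, h0]
  have hin : ∀ ρ ∈ Icc ((k i : ℝ) - 1) (k i + 1), ‖H ρ‖ ≤ B := by
    intro ρ hρ
    set m := √(1 + ρ ^ 2) with hm
    have hm2 : m ^ 2 = 1 + ρ ^ 2 := Real.sq_sqrt (by positivity)
    have hm1 : 1 ≤ m := Real.one_le_sqrt.2 (by nlinarith)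
    have hρm : |ρ| ≤ m := Real.abs_le_sqrt (by linarith)
    have hρk : |ρ - k i| ≤ 1 := abs_le.2 ⟨by linarith [hρ.1], by linarith [hρ.2]⟩
    have hkρ : |(k i : ℝ)| ≤ 2 * m := by
      have := abs_sub_abs_le_abs_sub (k i : ℝ) ρ
      rw [abs_sub_comm] at this
      linarith
    have hmκ : m ≤ 3 * κ := by
      have h1 := abs_sub_abs_le_abs_sub ρ (k i : ℝ)
      have h2 : m ≤ 1 + |ρ| := by
        rw [hm, Real.sqrt_le_left (by positivity)]
        nlinarith [sq_abs ρ, abs_nonneg ρ]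
      linarith
    have h := hC i s (ρ - k i) m (removeCoord i (latticePoint k)) (removeCoord i x) hρk hm1
      (by linarith) (by
        have : (0 : ℝ) ≤ n := by positivity
        nlinarith)
    have heq : H ρ = cexp (I * (x i * ρ : ℝ)) * ∫ w, cexp (I * (inner ℝ (removeCoord i x) w : ℝ)) *
        (cexp (I * (s * √(m ^ 2 + ‖w‖ ^ 2) : ℝ)) *
          φ (insertCoord i (ρ - k i) (w - removeCoord i (latticePoint k)))) := by
      rw [← integral_const_mul]
      refine integral_congr_ae (ae_of_all _ fun w => ?_)
      have e1 : kleinGordonSymbol s (insertCoord i ρ w) =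
          cexp (I * (s * √(m ^ 2 + ‖w‖ ^ 2) : ℝ)) := by
        rw [kleinGordonSymbol, japaneseBracket, norm_sq_insertCoord, hm2, add_assoc]
      simp only
      rw [e1, inner_insertCoord, insertCoord_sub, Complex.ofReal_add, mul_add, Complex.exp_add,
        mul_assoc]
      rfl
    rw [heq, norm_mul, norm_cexp_I_mul_ofReal, one_mul]
    refine h.trans ?_
    rw [hB]
    gcongr
    exact hC0 i
  have hnorm : ‖∫ ρ, H ρ‖ ≤ 2 * B := by
    rw [← setIntegral_eq_integral_of_forall_compl_eq_zero hout]
    have := norm_setIntegral_le_of_norm_le_const (μ := volume) (f := H) (C := B)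
      (s := Icc ((k i : ℝ) - 1) (k i + 1)) (by simp) hin
    rw [Real.volume_real_Icc_of_le (by linarith)] at this
    linarith
  rw [hK]
  refine hnorm.trans ?_
  rw [mul_assoc]
  gcongr
  rw [hB, mul_div_assoc, Real.mul_rpow (by norm_num) (by positivity), ← mul_assoc]
  gcongr
  exact Finset.single_le_sum (fun i _ => hC0 i) (Finset.mem_univ i)

/-- For `|t| ≤ ⟨k⟩` this shows that the decaying terms do not lower the minimum, so the trivial
kernel bound suffices; `t = 0` is included. -/
theorem ENNReal.one_le_rpow_mul_rpow_neg {a b : ℝ≥0∞} (hb : 1 ≤ b) (hb' : b ≠ ⊤)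
    {p q : ℝ} (hp : 0 ≤ p) (hpq : p ≤ q) (hab : a ≤ b) : 1 ≤ b ^ q * a ^ (-p) := by
  have h1 : b ^ p ≠ 0 := (ENNReal.rpow_pos (one_pos.trans_le hb) hb').ne'
  have h2 : b ^ p ≠ ⊤ := ENNReal.rpow_ne_top_of_nonneg hp hb'
  calc (1 : ℝ≥0∞) = b ^ p * (b ^ p)⁻¹ := (ENNReal.mul_inv_cancel h1 h2).symm
    _ ≤ b ^ q * a ^ (-p) := by
      rw [ENNReal.rpow_neg]
      gcongr

theorem enorm_le_mul_ofReal_rpow {x : ℂ} {C κ t p q : ℝ} (hC : 0 ≤ C) (hκ : 0 < κ) (ht : 0 < t)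
    (h : ‖x‖ ≤ C * (κ ^ q * t ^ (-p))) :
    ‖x‖ₑ ≤ ENNReal.ofReal C * (ENNReal.ofReal κ ^ q * ENNReal.ofReal t ^ (-p)) := by
  rw [ENNReal.ofReal_rpow_of_pos hκ, ENNReal.ofReal_rpow_of_pos ht,
    ← ENNReal.ofReal_mul (by positivity), ← ENNReal.ofReal_mul hC, ← ofReal_norm]
  exact ENNReal.ofReal_le_ofReal h

/-- The dispersive bound for the frequency localized kernel. -/
theorem exists_enorm_cubeKernel_le {d : ℕ} (hd : 1 ≤ d) {φ : EuclideanSpace ℝ (Fin d) → ℝ}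
    (hφ : IsUnitCubeCutoff φ) :
    ∃ C : ℝ, 1 ≤ C ∧ ∀ (s t : ℝ) (k : Fin d → ℤ) (x : EuclideanSpace ℝ (Fin d)), |s| = |t| →
      ‖cubeKernel φ s k x‖ₑ ≤ ENNReal.ofReal C * decayFactor k t := by
  obtain ⟨n, rfl⟩ : ∃ n, d = n + 1 := ⟨d - 1, by omega⟩
  obtain ⟨C₁, hC₁, h₁⟩ : ∃ C : ℝ, 0 ≤ C ∧ ∀ (s : ℝ) (k : Fin (n + 1) → ℤ)
      (x : EuclideanSpace ℝ (Fin (n + 1))), japaneseBracket (latticePoint k) ≤ |s| →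
      ‖cubeKernel φ s k x‖ ≤ C * (japaneseBracket (latticePoint k) / |s|) ^ ((n : ℝ) / 2) := by
    -- In dimension one no variable remains after slicing; the exponent is 0 and the trivial bound
    -- is the claim.
    rcases Nat.eq_zero_or_pos n with rfl | hn
    · refine ⟨∫ ξ, φ ξ, integral_nonneg hφ.nonneg, fun s k x _ => ?_⟩
      simpa using norm_cubeKernel_le hφ s k x
    · exact exists_norm_cubeKernel_le_slice hn hφ
  obtain ⟨C₂, hC₂, h₂⟩ := exists_norm_cubeKernel_le_full hd hφ
  have hI : 0 ≤ ∫ ξ, φ ξ := integral_nonneg hφ.nonneg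
  set C : ℝ := 1 + (∫ ξ, φ ξ) + C₁ + C₂ with hC
  refine ⟨C, by linarith, fun s t k x hst => ?_⟩
  set κ := japaneseBracket (latticePoint k) with hκ
  have hκ1 : 1 ≤ κ := one_le_japaneseBracket _
  have hκ0 : 0 < κ := one_pos.trans_le hκ1
  have h0 : ‖cubeKernel φ s k x‖ₑ ≤ ENNReal.ofReal C := by
    rw [← ofReal_norm]
    exact ENNReal.ofReal_le_ofReal ((norm_cubeKernel_le hφ s k x).trans (by linarith))
  rcases le_total |t| κ with h | h
  · have hab : ENNReal.ofReal |t| ≤ ENNReal.ofReal κ := ENNReal.ofReal_le_ofReal h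
    have hone : 1 ≤ decayFactor k t := by
      refine le_min le_rfl (le_min ?_ ?_)
      · exact ENNReal.one_le_rpow_mul_rpow_neg
          (ENNReal.one_le_ofReal.2 hκ1) ENNReal.ofReal_ne_top
          (by push_cast; rw [add_sub_cancel_right]; positivity) le_rfl hab
      · exact ENNReal.one_le_rpow_mul_rpow_neg
          (ENNReal.one_le_ofReal.2 hκ1) ENNReal.ofReal_ne_top
          (by positivity) (by linarith) hab
    exact h0.trans (le_mul_of_one_le_right' hone)
  · have ht0 : 0 < |t| := by linarith
    have e1 := h₁ s k x (by rw [hst]; exact h)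
    have e2 := h₂ s k x (by rw [hst]; exact h)
    rw [hst, Real.div_rpow hκ0.le ht0.le, div_eq_mul_inv, ← Real.rpow_neg ht0.le] at e1
    rw [hst] at e2
    have f1 := enorm_le_mul_ofReal_rpow hC₁ hκ0 ht0 e1
    have f2 := enorm_le_mul_ofReal_rpow hC₂ hκ0 ht0 e2
    rw [decayFactor, mul_min, mul_min, mul_one]
    refine le_min h0 (le_min ?_ ?_)
    · rw [show ((((n + 1 : ℕ) : ℝ) - 1) / 2) = (n : ℝ) / 2 by push_cast; ring]
      refine f1.trans ?_
      gcongr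
      linarith
    · refine f2.trans ?_
      gcongr
      linarith

end KernelDecay

/-! ### Interpolation between `L¹ → L^∞` and `L² → L²` -/

section Interpolation

open Set Filter Topology Complex FourierTransform Complex.HadamardThreeLines

/-- The exponent has real part in `[1/2, 1]`, so the two extreme powers dominate on the whole strip.
-/
theorem norm_ofReal_cpow_half_le {R : ℝ} (hR : 0 ≤ R) {ζ : ℂ} (hζ : ζ ∈ verticalClosedStrip 0 1) :
    ‖(R : ℂ) ^ ((1 + ζ) / 2)‖ ≤ R ^ (1 / 2 : ℝ) + R := by
  have h0 : 0 ≤ ζ.re := hζ.1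
  have h1 : ζ.re ≤ 1 := hζ.2
  have hre : ((1 + ζ) / 2).re = (1 + ζ.re) / 2 := by simp
  rw [Complex.norm_cpow_eq_rpow_re_of_nonneg hR (by rw [hre]; positivity), hre]
  have h2 : 0 ≤ R ^ (1 / 2 : ℝ) := by positivity
  rcases le_total R 1 with h | h
  · have := Real.rpow_le_rpow_of_exponent_ge_of_imp hR h
      (show (1 / 2 : ℝ) ≤ (1 + ζ.re) / 2 by linarith) (fun _ h => by linarith)
    linarith
  · have := Real.rpow_le_rpow_of_exponent_le h (show (1 + ζ.re) / 2 ≤ (1 : ℝ) by linarith)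
    rw [Real.rpow_one] at this
    linarith

theorem one_add_div_two_ne_zero {ζ : ℂ} (hζ : ζ ∈ verticalClosedStrip 0 1) : (1 + ζ) / 2 ≠ 0 := by
  intro h
  have h0 : 0 ≤ ζ.re := hζ.1
  have := congrArg Complex.re h
  simp at this
  linarith

/-- An integral `∫ c R^{(1+ζ)/2}` is admissible for the three lines theorem. -/
theorem diffContOnCl_integral_cpow {α : Type*} [MeasurableSpace α] {μ : Measure α} {c : α → ℂ}
    {R : α → ℝ} {D : ℝ} (hc : AEStronglyMeasurable c μ) (hcD : ∀ a, ‖c a‖ ≤ D) (hR : ∀ a, 0 ≤ R a)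
    (hR1 : Integrable R μ) (hR2 : Integrable (fun a => R a ^ (1 / 2 : ℝ)) μ) :
    DiffContOnCl ℂ (fun ζ => ∫ a, c a * (R a : ℂ) ^ ((1 + ζ) / 2) ∂μ) (verticalStrip 0 1) ∧
      BddAbove ((norm ∘ fun ζ => ∫ a, c a * (R a : ℂ) ^ ((1 + ζ) / 2) ∂μ) ''
        verticalClosedStrip 0 1) := by
  have hdom : Integrable (fun a => D * (R a ^ (1 / 2 : ℝ) + R a)) μ := (hR2.add hR1).const_mul D
  have hbound : ∀ ζ ∈ verticalClosedStrip 0 1, ∀ a,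
      ‖c a * (R a : ℂ) ^ ((1 + ζ) / 2)‖ ≤ D * (R a ^ (1 / 2 : ℝ) + R a) := by
    intro ζ hζ a
    rw [norm_mul]
    have := (norm_nonneg _).trans (hcD a)
    exact mul_le_mul (hcD a) (norm_ofReal_cpow_half_le (hR a) hζ) (norm_nonneg _) this
  have hmeas : ∀ ζ : ℂ, AEStronglyMeasurable (fun a => c a * (R a : ℂ) ^ ((1 + ζ) / 2)) μ := by
    intro ζ
    have := hR1.aestronglyMeasurable.aemeasurable
    exact hc.mul (AEMeasurable.aestronglyMeasurable (by fun_prop))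
  have hopen : IsOpen (verticalStrip 0 1) := isOpen_Ioo.preimage continuous_re
  have hsub : verticalStrip 0 1 ⊆ verticalClosedStrip 0 1 := preimage_mono Ioo_subset_Icc_self
  have hcl : closure (verticalStrip 0 1) ⊆ verticalClosedStrip 0 1 :=
    closure_minimal hsub (isClosed_Icc.preimage continuous_re)
  refine ⟨⟨?_, ?_⟩, ?_⟩
  · refine differentiableOn_integral_of_locally_dominated hopen (fun ζ _ => hmeas ζ)
      (ae_of_all _ fun a ζ hζ => ?_) fun ζ₀ hζ₀ => ⟨_, hopen.mem_nhds hζ₀, _, hdom,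
        ae_of_all _ fun a ζ hζ => hbound ζ (hsub hζ) a⟩
    refine DifferentiableAt.differentiableWithinAt ?_
    have h : DifferentiableAt ℂ (fun ζ : ℂ => (1 + ζ) / 2) ζ := by fun_prop
    exact DifferentiableAt.const_mul (h.const_cpow (Or.inr
      (one_add_div_two_ne_zero (hsub hζ)))) _
  · refine continuousOn_of_dominated (fun ζ _ => hmeas ζ)
      (fun ζ hζ => ae_of_all _ fun a => hbound ζ (hcl hζ) a) hdom (ae_of_all _ fun a ζ hζ => ?_)
    refine ContinuousAt.continuousWithinAt ?_
    refine continuousAt_const.mul (ContinuousAt.const_cpow (by fun_prop)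
      (Or.inr (one_add_div_two_ne_zero (hcl hζ))))
  · refine ⟨∫ a, D * (R a ^ (1 / 2 : ℝ) + R a) ∂μ, ?_⟩
    rintro _ ⟨ζ, hζ, rfl⟩
    exact norm_integral_le_of_norm_le hdom (ae_of_all _ (hbound ζ hζ))

variable {V : Type*} [NormedAddCommGroup V] [InnerProductSpace ℝ V] [FiniteDimensional ℝ V]
  [MeasurableSpace V] [BorelSpace V]

/-- Interpolation for the bilinear form of a convolution kernel, tested on `A^{(1+θ)/2}` and
`B^{(1+θ)/2}`. -/
theorem norm_integral_kernel_le_of_interpolation {κ : V → ℂ} (hκ : Continuous κ) {D : ℝ}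
    (hD : ∀ x, ‖κ x‖ ≤ D)
    (hL2 : ∀ u v : V → ℂ, Integrable u → Integrable v → Integrable (fun y => ‖u y‖ ^ 2) →
      Integrable (fun x => ‖v x‖ ^ 2) → ‖∫ p : V × V, κ (p.1 - p.2) * (u p.2 * v p.1)‖ ≤
        √(∫ y, ‖u y‖ ^ 2) * √(∫ x, ‖v x‖ ^ 2))
    {A B : V → ℝ} (hA : ∀ y, 0 ≤ A y) (hB : ∀ x, 0 ≤ B x) (hA1 : Integrable A)
    (hA2 : Integrable fun y => A y ^ (1 / 2 : ℝ)) (hB1 : Integrable B)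
    (hB2 : Integrable fun x => B x ^ (1 / 2 : ℝ)) {σ τ : V → ℂ} (hσ : Measurable σ)
    (hτ : Measurable τ) (hσ1 : ∀ y, ‖σ y‖ ≤ 1) (hτ1 : ∀ x, ‖τ x‖ ≤ 1) {θ : ℝ}
    (hθ : θ ∈ Icc (0 : ℝ) 1) :
    ‖∫ p : V × V, κ (p.1 - p.2) * ((σ p.2 * (A p.2 ^ ((1 + θ) / 2) : ℝ)) *
      (τ p.1 * (B p.1 ^ ((1 + θ) / 2) : ℝ)))‖ ≤
      (√(∫ y, A y) * √(∫ x, B x)) ^ (1 - θ) * (D * ((∫ y, A y) * ∫ x, B x)) ^ θ := by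
  have hD0 : 0 ≤ D := (norm_nonneg _).trans (hD 0)
  set c : V × V → ℂ := fun p => κ (p.1 - p.2) * (σ p.2 * τ p.1) with hc
  set R : V × V → ℝ := fun p => A p.2 * B p.1 with hR
  have hR0 : ∀ p, 0 ≤ R p := fun p => mul_nonneg (hA _) (hB _)
  have hcm : AEStronglyMeasurable c (volume.prod volume) := by
    have := hκ.measurable
    exact Measurable.aestronglyMeasurable (by fun_prop)
  have hστ : ∀ p : V × V, ‖σ p.2 * τ p.1‖ ≤ 1 := fun p => by
    rw [norm_mul]
    exact mul_le_one₀ (hσ1 _) (norm_nonneg _) (hτ1 _)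
  have hcD : ∀ p, ‖c p‖ ≤ D := fun p => by
    rw [hc, norm_mul]
    exact (mul_le_mul (hD _) (hστ p) (norm_nonneg _) hD0).trans_eq (mul_one D)
  have hR1 : Integrable R (volume.prod volume) :=
    (hB1.mul_prod hA1).congr (ae_of_all _ fun p => mul_comm _ _)
  have hR2 : Integrable (fun p => R p ^ (1 / 2 : ℝ)) (volume.prod volume) := by
    refine (hB2.mul_prod hA2).congr (ae_of_all _ fun p => ?_)
    simp only [hR]
    rw [Real.mul_rpow (hA _) (hB _), mul_comm]
  obtain ⟨hdiff, hbdd⟩ := diffContOnCl_integral_cpow hcm hcD hR0 hR1 hR2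
  set F : ℂ → ℂ := fun ζ => ∫ p, c p * (R p : ℂ) ^ ((1 + ζ) / 2) ∂(volume.prod volume) with hF
  have hFeq : ∀ ζ : ℂ, F ζ = ∫ p : V × V, κ (p.1 - p.2) *
      ((σ p.2 * (A p.2 : ℂ) ^ ((1 + ζ) / 2)) * (τ p.1 * (B p.1 : ℂ) ^ ((1 + ζ) / 2))) := by
    intro ζ
    refine integral_congr_ae (ae_of_all _ fun p => ?_)
    simp only [hc, hR]
    rw [Complex.ofReal_mul, Complex.mul_cpow_ofReal_nonneg (hA _) (hB _)]
    ring
  -- On `Re ζ = 0` the test functions have moduli at most `A^{1/2}` and `B^{1/2}`, so the `L²` bound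
  -- applies; on `Re ζ = 1` the moduli are at most `A` and `B`, and the supremum of the kernel
  -- suffices.
  have hzero : ∀ ζ ∈ re ⁻¹' {0}, ‖F ζ‖ ≤ √(∫ y, A y) * √(∫ x, B x) := by
    intro ζ hζ
    have hζ0 : ζ.re = 0 := hζ
    have hre : ((1 + ζ) / 2).re = 1 / 2 := by simp [hζ0]
    have hpow : ∀ a : ℝ, 0 ≤ a → ‖(a : ℂ) ^ ((1 + ζ) / 2)‖ = a ^ (1 / 2 : ℝ) := fun a ha => by
      rw [Complex.norm_cpow_eq_rpow_re_of_nonneg ha (by rw [hre]; norm_num), hre]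
    have hpow2 : ∀ a : ℝ, 0 ≤ a → (a ^ (1 / 2 : ℝ)) ^ 2 = a := fun a ha => by
      rw [← Real.sqrt_eq_rpow, Real.sq_sqrt ha]
    have key : ∀ (s : V → ℂ) (N : V → ℝ), Measurable s → (∀ x, ‖s x‖ ≤ 1) → (∀ x, 0 ≤ N x) →
        Integrable N → Integrable (fun x => N x ^ (1 / 2 : ℝ)) →
        Integrable (fun x => s x * (N x : ℂ) ^ ((1 + ζ) / 2)) ∧
        Integrable (fun x => ‖s x * (N x : ℂ) ^ ((1 + ζ) / 2)‖ ^ 2) ∧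
        ∫ x, ‖s x * (N x : ℂ) ^ ((1 + ζ) / 2)‖ ^ 2 ≤ ∫ x, N x := by
      intro s N hs hs1 hN hN1 hN2
      have hNm := hN1.aestronglyMeasurable.aemeasurable
      have hm : AEStronglyMeasurable (fun x => s x * (N x : ℂ) ^ ((1 + ζ) / 2)) volume :=
        AEMeasurable.aestronglyMeasurable (by fun_prop)
      have hle : ∀ x, ‖s x * (N x : ℂ) ^ ((1 + ζ) / 2)‖ ≤ N x ^ (1 / 2 : ℝ) := fun x => by
        rw [norm_mul, hpow _ (hN x)]
        exact mul_le_of_le_one_left (Real.rpow_nonneg (hN x) _) (hs1 x)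
      have hle2 : ∀ x, ‖s x * (N x : ℂ) ^ ((1 + ζ) / 2)‖ ^ 2 ≤ N x := fun x => by
        rw [← hpow2 _ (hN x)]
        gcongr
        rw [hpow2 _ (hN x)]
        exact hle x
      have hi2 : Integrable (fun x => ‖s x * (N x : ℂ) ^ ((1 + ζ) / 2)‖ ^ 2) := by
        refine hN1.mono' (hm.norm.pow 2) (ae_of_all _ fun x => ?_)
        rw [Real.norm_of_nonneg (by positivity)]
        exact hle2 x
      exact ⟨hN2.mono' hm (ae_of_all _ hle), hi2, integral_mono hi2 hN1 hle2⟩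
    obtain ⟨u1, u2, u3⟩ := key σ A hσ hσ1 hA hA1 hA2
    obtain ⟨v1, v2, v3⟩ := key τ B hτ hτ1 hB hB1 hB2
    rw [hFeq]
    refine (hL2 _ _ u1 v1 u2 v2).trans ?_
    gcongr
  have hone : ∀ ζ ∈ re ⁻¹' {1}, ‖F ζ‖ ≤ D * ((∫ y, A y) * ∫ x, B x) := by
    intro ζ hζ
    have hζ1 : ζ.re = 1 := hζ
    have hre : ((1 + ζ) / 2).re = 1 := by
      simp [hζ1]
    have h1 : ∫ p, D * R p ∂(volume.prod volume) = D * ((∫ y, A y) * ∫ x, B x) := by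
      rw [integral_const_mul]
      congr 1
      have := integral_prod_mul (μ := (volume : Measure V)) (ν := (volume : Measure V)) B A
      rw [mul_comm, ← this]
      congr 1
      ext p
      exact mul_comm _ _
    rw [← h1]
    refine norm_integral_le_of_norm_le (hR1.const_mul D) (ae_of_all _ fun p => ?_)
    rw [norm_mul, Complex.norm_cpow_eq_rpow_re_of_nonneg (hR0 p) (by rw [hre]; norm_num), hre,
      Real.rpow_one]
    gcongr
    · exact hR0 p
    · exact hcD p
  have hθs : (θ : ℂ) ∈ verticalClosedStrip 0 1 := by
    change (θ : ℂ).re ∈ Icc (0 : ℝ) 1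
    simpa using hθ
  have hmain := norm_le_interp_of_mem_verticalClosedStrip₀₁' F hθs hdiff hbdd hzero hone
  rw [hFeq, Complex.ofReal_re] at hmain
  have hexp : ∀ a : ℝ, 0 ≤ a → ((a ^ ((1 + θ) / 2) : ℝ) : ℂ) = (a : ℂ) ^ ((1 + (θ : ℂ)) / 2) := by
    intro a ha
    rw [Complex.ofReal_cpow ha]
    push_cast
    rfl
  simp only [hexp _ (hA _), hexp _ (hB _)]
  exact hmain

end Interpolation

/-! ### Fourier multipliers on `L²` and the interpolated bound for Schwartz functions -/

section MultiplierBounds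

open Set Filter Topology Complex FourierTransform

variable {V : Type*} [NormedAddCommGroup V] [InnerProductSpace ℝ V] [FiniteDimensional ℝ V]
  [MeasurableSpace V] [BorelSpace V]

theorem continuous_fourier_of_integrable {u : V → ℂ} (hu : Integrable u) : Continuous (𝓕 u) :=
  VectorFourier.fourierIntegral_continuous Real.continuous_fourierChar
    (by exact continuous_inner) hu

theorem integral_fourier_mul_eq_of_integrable {u v : V → ℂ} (hu : Integrable u)
    (hv : Integrable v) : ∫ ξ, 𝓕 u ξ * v ξ = ∫ x, u x * 𝓕 v x := by
  simpa using! VectorFourier.integral_bilin_fourierIntegral_eq_flip (ContinuousLinearMap.mul ℂ ℂ)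
    (L := innerₗ V) Real.continuous_fourierChar continuous_inner hu hv

/-- On `L¹ ∩ L²` the Fourier integral is the `L²` Fourier transform. -/
theorem fourier_ae_eq_fourier_toLp {u : V → ℂ} (hu : Integrable u) (hu2 : MemLp u 2) :
    (𝓕 (hu2.toLp u) : Lp ℂ 2 (volume : Measure V)) =ᵐ[volume] 𝓕 u := by
  refine ae_eq_of_integral_contDiff_smul_eq
    ((Lp.memLp _).locallyIntegrable one_le_two)
    (continuous_fourier_of_integrable hu).locallyIntegrable fun g hg hgc => ?_
  have hg₁ : HasCompactSupport (Complex.ofRealCLM ∘ g) := hgc.comp_left rfl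
  have hg₂ : ContDiff ℝ ∞ (Complex.ofRealCLM ∘ g) := by fun_prop
  set Ψ : 𝓢(V, ℂ) := hg₁.toSchwartzMap hg₂ with hΨ
  -- The `L²` transform agrees with the distributional one, which is defined by moving `𝓕` to the
  -- test function; for integrable `u` it can be moved back.
  have h1 := congrArg (fun T : 𝓢'(V, ℂ) => T Ψ) (Lp.fourier_toTemperedDistribution_eq (hu2.toLp u))
  simp only [TemperedDistribution.fourier_apply, Lp.toTemperedDistribution_apply] at h1
  have h2 : ∫ x, (𝓕 Ψ) x • (hu2.toLp u) x = ∫ x, 𝓕 (Ψ : V → ℂ) x * u x := by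
    refine integral_congr_ae ?_
    filter_upwards [hu2.coeFn_toLp] with x hx
    rw [hx, SchwartzMap.fourier_coe, smul_eq_mul]
  rw [h2, integral_fourier_mul_eq_of_integrable Ψ.integrable hu] at h1
  have h3 : ∀ x, Ψ x = (g x : ℂ) := fun x => rfl
  simp only [h3, smul_eq_mul] at h1
  simpa using h1.symm

theorem memLp_fourier {u : V → ℂ} (hu : Integrable u) (hu2 : MemLp u 2) : MemLp (𝓕 u) 2 :=
  (Lp.memLp _).ae_eq (fourier_ae_eq_fourier_toLp hu hu2)

theorem integral_norm_sq_fourier {u : V → ℂ} (hu : Integrable u) (hu2 : MemLp u 2) :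
    ∫ ξ, ‖𝓕 u ξ‖ ^ (2 : ℝ) = ∫ x, ‖u x‖ ^ (2 : ℝ) := by
  have h1 : eLpNorm (𝓕 u) 2 volume = eLpNorm u 2 volume := by
    rw [← eLpNorm_congr_ae (fourier_ae_eq_fourier_toLp hu hu2)]
    have := Lp.norm_fourier_eq (hu2.toLp u)
    rw [← enorm_eq_iff_norm_eq, Lp.enorm_def, Lp.enorm_toLp] at this
    exact this
  rw [(memLp_fourier hu hu2).eLpNorm_eq_integral_rpow_norm two_ne_zero ENNReal.ofNat_ne_top,
    hu2.eLpNorm_eq_integral_rpow_norm two_ne_zero ENNReal.ofNat_ne_top,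
    ENNReal.ofReal_eq_ofReal_iff (by positivity) (by positivity),
    Real.rpow_left_inj (by positivity) (by positivity) (by simp)] at h1
  simpa using h1

/-- The convolution with `𝓕⁻ M` is the multiplier `M`. -/
theorem integral_fourierInv_sub_mul {M u : V → ℂ} (hM : Integrable M) (hu : Integrable u) (x : V) :
    ∫ y, 𝓕⁻ M (x - y) * u y = 𝓕⁻ (fun η => M η * 𝓕 u η) x := by
  set F : V → V → ℂ := fun y η =>
    cexp ((2 * Real.pi * inner ℝ η (x - y) : ℝ) * I) * (u y * M η) with hF
  have hFint : Integrable (Function.uncurry F) (volume.prod volume) := by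
    refine (hu.mul_prod hM).mono ?_ (ae_of_all _ fun q => le_of_eq ?_)
    · refine AEStronglyMeasurable.mul (Continuous.aestronglyMeasurable ?_)
        (hu.mul_prod hM).aestronglyMeasurable
      fun_prop
    · simp only [Function.uncurry_def, hF]
      rw [norm_mul, Complex.norm_exp_ofReal_mul_I, one_mul]
  have h1 : ∀ y, 𝓕⁻ M (x - y) * u y = ∫ η, F y η := by
    intro y
    rw [Real.fourierInv_eq', ← integral_mul_const]
    congr 1
    ext η
    simp only [hF, smul_eq_mul]
    ring
  simp only [h1]
  rw [integral_integral_swap hFint, Real.fourierInv_eq']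
  congr 1
  ext η
  rw [Real.fourier_eq', smul_eq_mul, ← integral_const_mul, ← integral_const_mul]
  congr 1
  ext y
  simp only [hF, smul_eq_mul]
  have : cexp ((2 * Real.pi * inner ℝ η (x - y) : ℝ) * I) =
      cexp ((2 * Real.pi * inner ℝ η x : ℝ) * I) * cexp ((-2 * Real.pi * inner ℝ y η : ℝ) * I) := by
    rw [← Complex.exp_add, inner_sub_right, real_inner_comm η y]
    congr 1
    push_cast
    ring
  rw [this]
  ring

theorem continuous_fourierInv_of_integrable {M : V → ℂ} (hM : Integrable M) :
    Continuous (𝓕⁻ M) := by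
  have : 𝓕⁻ M = fun x => 𝓕 M (-x) := funext fun x => Real.fourierInv_eq_fourier_neg M x
  rw [this]
  exact (continuous_fourier_of_integrable hM).comp continuous_neg

theorem norm_fourierInv_le {M : V → ℂ} (x : V) : ‖𝓕⁻ M x‖ ≤ ∫ η, ‖M η‖ := by
  rw [Real.fourierInv_eq_fourier_neg]
  exact VectorFourier.norm_fourierIntegral_le_integral_norm _ _ _ _ _

theorem integral_prod_fourierInv_sub {M u v : V → ℂ} (hM : Integrable M) (hu : Integrable u)
    (hv : Integrable v) : ∫ p : V × V, 𝓕⁻ M (p.1 - p.2) * (u p.2 * v p.1) =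
      ∫ x, v x * 𝓕⁻ (fun η => M η * 𝓕 u η) x := by
  have hc := continuous_fourierInv_of_integrable hM
  have hInt : Integrable (fun p : V × V => 𝓕⁻ M (p.1 - p.2) * (u p.2 * v p.1))
      (volume.prod volume) := by
    have h1 : Integrable (fun p : V × V => u p.2 * v p.1) (volume.prod volume) :=
      (hv.mul_prod hu).congr (ae_of_all _ fun p => mul_comm _ _)
    refine h1.bdd_mul (c := ∫ η, ‖M η‖) (Continuous.aestronglyMeasurable (by fun_prop))
      (ae_of_all _ fun p => norm_fourierInv_le _)
  have h2 : ∫ p : V × V, 𝓕⁻ M (p.1 - p.2) * (u p.2 * v p.1) =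
      ∫ x, ∫ y, 𝓕⁻ M (x - y) * (u y * v x) := integral_prod _ hInt
  rw [h2]
  congr 1
  ext x
  rw [← integral_fourierInv_sub_mul hM hu x, ← integral_const_mul]
  congr 1
  ext y
  ring

/-- The `L²` bound for a multiplier bounded by `1`. -/
theorem norm_integral_prod_fourierInv_sub_le {M u v : V → ℂ}
    (hM : Integrable M) (hM1 : ∀ η, ‖M η‖ ≤ 1) (hu : Integrable u) (hv : Integrable v)
    (hu2 : Integrable fun y => ‖u y‖ ^ 2) (hv2 : Integrable fun x => ‖v x‖ ^ 2) :
    ‖∫ p : V × V, 𝓕⁻ M (p.1 - p.2) * (u p.2 * v p.1)‖ ≤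
      √(∫ y, ‖u y‖ ^ 2) * √(∫ x, ‖v x‖ ^ 2) := by
  have hu2' : MemLp u 2 := (memLp_two_iff_integrable_sq_norm hu.aestronglyMeasurable).2 hu2
  have hv' : Integrable (fun x => v (-x)) := hv.comp_neg
  have hv2' : MemLp (fun x => v (-x)) 2 :=
    (memLp_two_iff_integrable_sq_norm hv'.aestronglyMeasurable).2 hv2.comp_neg
  have hFu := continuous_fourier_of_integrable hu
  have hMu : Integrable fun η => M η * 𝓕 u η := by
    refine hM.mul_bdd (c := ∫ y, ‖u y‖) hFu.aestronglyMeasurable (ae_of_all _ fun η => ?_)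
    exact VectorFourier.norm_fourierIntegral_le_integral_norm _ _ _ _ _
  -- Reflecting `v` turns `𝓕⁻` into `𝓕`, which moves across the pairing; Cauchy–Schwarz and
  -- Plancherel conclude.
  have h1 : ∫ x, v x * 𝓕⁻ (fun η => M η * 𝓕 u η) x =
      ∫ η, 𝓕 (fun x => v (-x)) η * (M η * 𝓕 u η) := by
    rw [integral_fourier_mul_eq_of_integrable hv' hMu, ← integral_neg_eq_self]
    congr 1
    ext x
    rw [Real.fourierInv_eq_fourier_neg, neg_neg]
  rw [integral_prod_fourierInv_sub hM hu hv, h1]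
  have m1 := memLp_fourier hu hu2'
  have m2 := memLp_fourier hv' hv2'
  have hconj : (2 : ℝ).HolderConjugate 2 := Real.HolderConjugate.two_two
  have hH := integral_mul_le_Lp_mul_Lq_of_nonneg (μ := (volume : Measure V)) hconj
    (f := fun η => ‖𝓕 u η‖) (g := fun η => ‖𝓕 (fun x => v (-x)) η‖)
    (ae_of_all _ fun _ => norm_nonneg _) (ae_of_all _ fun _ => norm_nonneg _)
    (by simpa using m1.norm) (by simpa using m2.norm)
  rw [integral_norm_sq_fourier hu hu2', integral_norm_sq_fourier hv' hv2',
    integral_neg_eq_self (fun x => ‖v x‖ ^ (2 : ℝ)), ← Real.sqrt_eq_rpow, ← Real.sqrt_eq_rpow] at hH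
  simp only [Real.rpow_two] at hH
  refine le_trans ?_ hH
  refine norm_integral_le_of_norm_le (m1.norm.integrable_mul m2.norm) (ae_of_all _ fun η => ?_)
  rw [norm_mul, norm_mul, mul_comm]
  gcongr
  exact mul_le_of_le_one_left (norm_nonneg _) (hM1 η)

theorem SchwartzMap.integrable_norm_rpow (f : 𝓢(V, ℂ)) {p : ℝ} (hp : 0 < p) :
    Integrable fun x => ‖f x‖ ^ p := by
  have := (f.memLp (ENNReal.ofReal p) volume).integrable_norm_rpow
    (by simpa using hp) ENNReal.ofReal_ne_top
  rwa [ENNReal.toReal_ofReal hp.le] at this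

/-- The total power of `ab` on the right is `1/r + (1 - 2/r) = 1/r'`. Cancelling `b^{1/r'}` leaves
`b^{1/r}`; the case `b = 0` is separate. -/
theorem rpow_inv_le_of_interpolated {a b D r r' : ℝ} (ha : 0 ≤ a) (hb : 0 ≤ b) (hD : 0 ≤ D)
    (hr : 2 ≤ r) (hrr' : r.HolderConjugate r')
    (h : b ≤ (√a * √b) ^ (1 - (1 - 2 / r)) * (D * (a * b)) ^ (1 - 2 / r)) :
    b ^ r⁻¹ ≤ D ^ (1 - 2 / r) * a ^ r'⁻¹ := by
  have hr0 : 0 < r := by linarith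
  have hθ : 0 ≤ 1 - 2 / r := by
    rw [sub_nonneg, div_le_one hr0]
    exact hr
  have hsum : r⁻¹ + r'⁻¹ = 1 := hrr'.inv_add_inv_eq_one
  rcases hb.eq_or_lt with rfl | hb0
  · rw [Real.zero_rpow (inv_ne_zero hr0.ne')]
    positivity
  have hr'0 : 0 < r' := hrr'.symm.pos
  have h1 : (√a * √b) ^ (1 - (1 - 2 / r)) * (D * (a * b)) ^ (1 - 2 / r) =
      D ^ (1 - 2 / r) * a ^ r'⁻¹ * b ^ r'⁻¹ := by
    have e1 : (√a * √b) ^ (1 - (1 - 2 / r)) = (a * b) ^ r⁻¹ := by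
      rw [← Real.sqrt_mul ha, Real.sqrt_eq_rpow, ← Real.rpow_mul (by positivity)]
      congr 1
      field_simp
      ring
    rw [e1, Real.mul_rpow hD (by positivity), mul_left_comm,
      ← Real.rpow_add_of_nonneg (by positivity) (by positivity) hθ]
    have e2 : r⁻¹ + (1 - 2 / r) = r'⁻¹ := by
      rw [eq_sub_of_add_eq' hsum, div_eq_mul_inv]
      ring
    rw [e2, Real.mul_rpow ha hb, mul_assoc]
  rw [h1] at h
  have h2 : b = b ^ r⁻¹ * b ^ r'⁻¹ := by
    rw [← Real.rpow_add hb0, hsum, Real.rpow_one]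
  nth_rewrite 1 [h2] at h
  exact le_of_mul_le_mul_right h (by positivity)

/-- The interpolated bound for a Fourier multiplier acting on Schwartz functions. -/
theorem integral_norm_rpow_multiplier_le {M : V → ℂ} (hM : Integrable M)
    (hM1 : ∀ η, ‖M η‖ ≤ 1) {D : ℝ} (hD : ∀ x, ‖𝓕⁻ M x‖ ≤ D) {f h : 𝓢(V, ℂ)}
    (hh : ∀ x, h x = 𝓕⁻ (fun η => M η * 𝓕 (f : V → ℂ) η) x) {r r' : ℝ} (hr : 2 ≤ r)
    (hrr' : r.HolderConjugate r') :
    (∫ x, ‖h x‖ ^ r) ^ r⁻¹ ≤ D ^ (1 - 2 / r) * (∫ y, ‖f y‖ ^ r') ^ r'⁻¹ := by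
  have hr0 : 0 < r := by linarith
  have hr'0 : 0 < r' := hrr'.symm.pos
  have hD0 : 0 ≤ D := (norm_nonneg _).trans (hD 0)
  have hsum : r⁻¹ + r'⁻¹ = 1 := hrr'.inv_add_inv_eq_one
  have hθ : 1 - 2 / r ∈ Icc (0 : ℝ) 1 := by
    constructor
    · rw [sub_nonneg, div_le_one hr0]
      exact hr
    · linarith [show 0 ≤ 2 / r by positivity]
  have hhalf : (1 + (1 - 2 / r)) / 2 = r'⁻¹ := by
    rw [eq_sub_of_add_eq' hsum]
    field_simp
    ring
  refine rpow_inv_le_of_interpolated (by positivity) (by positivity) hD0 hr hrr' ?_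
  have hsq : ∀ (g : 𝓢(V, ℂ)) (p : ℝ), 0 < p →
      Integrable fun x => (‖g x‖ ^ p) ^ (1 / 2 : ℝ) := fun g p hp => by
    simp only [← Real.rpow_mul (norm_nonneg _)]
    exact g.integrable_norm_rpow (by positivity)
  have hunit : ∀ z : ℂ, ‖z / ‖z‖‖ ≤ 1 := fun z => by
    rw [norm_div, Complex.norm_real, norm_norm]
    exact div_self_le_one _
  have hfm : Measurable f := f.continuous.measurable
  have hhm : Measurable h := h.continuous.measurable
  -- With `θ = 1 - 2/r` the exponent `(1 + θ)/2` is `1/r'`, so the first test function is `f`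
  -- itself. The second has modulus `|h|^{r/r'} = |h|^{r-1}` and the phase of `conj h`, so its
  -- pairing with `h` is `∫ |h|^r`. The phases are 0 at zeros, by division by zero.
  have key := norm_integral_kernel_le_of_interpolation (continuous_fourierInv_of_integrable hM) hD
    (fun u v hu hv hu2 hv2 => norm_integral_prod_fourierInv_sub_le hM hM1 hu hv hu2 hv2)
    (A := fun y => ‖f y‖ ^ r') (B := fun x => ‖h x‖ ^ r) (fun y => by positivity)
    (fun x => by positivity) (f.integrable_norm_rpow hr'0) (hsq f r' hr'0)
    (h.integrable_norm_rpow hr0) (hsq h r hr0) (σ := fun y => f y / ‖f y‖)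
    (τ := fun x => (starRingEnd ℂ) (h x) / ‖(starRingEnd ℂ) (h x)‖) (by fun_prop)
    (by
      have : Measurable fun x => (starRingEnd ℂ) (h x) :=
        Complex.continuous_conj.measurable.comp hhm
      fun_prop) (fun y => hunit _) (fun x => hunit _) hθ
  refine le_trans (le_of_eq ?_) key
  rw [hhalf]
  have e1 : ∀ y, f y / ‖f y‖ * (((‖f y‖ ^ r') ^ r'⁻¹ : ℝ) : ℂ) = f y := by
    intro y
    rw [Real.rpow_rpow_inv (norm_nonneg _) hr'0.ne']
    by_cases h0 : f y = 0
    · simp [h0]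
    · rw [div_mul_cancel₀]
      simpa using h0
  set v : V → ℂ := fun x => (starRingEnd ℂ) (h x) / ‖(starRingEnd ℂ) (h x)‖ *
    (((‖h x‖ ^ r) ^ r'⁻¹ : ℝ) : ℂ) with hv
  have hvh : ∀ x, v x * h x = ((‖h x‖ ^ r : ℝ) : ℂ) := by
    intro x
    by_cases h0 : h x = 0
    · simp [hv, h0, Real.zero_rpow hr0.ne']
    · have hn : 0 < ‖h x‖ := norm_pos_iff.2 h0
      have hnc : (‖h x‖ : ℂ) ≠ 0 := by exact_mod_cast hn.ne'
      have e2 : (‖h x‖ ^ r) ^ r'⁻¹ * ‖h x‖ = ‖h x‖ ^ r := by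
        rw [← Real.rpow_mul hn.le, ← Real.rpow_add_one hn.ne']
        congr 1
        rw [eq_sub_of_add_eq' hsum, mul_sub, mul_inv_cancel₀ hr0.ne']
        ring
      have e3 : (starRingEnd ℂ) (h x) * h x = (‖h x‖ : ℂ) * ‖h x‖ := by
        rw [mul_comm, Complex.mul_conj, Complex.normSq_eq_norm_sq]
        push_cast
        ring
      simp only [hv]
      rw [RCLike.norm_conj]
      calc _ = ((starRingEnd ℂ) (h x) * h x) / ‖h x‖ * (((‖h x‖ ^ r) ^ r'⁻¹ : ℝ) : ℂ) := by ring
        _ = _ := by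
          rw [e3, mul_div_cancel_right₀ _ hnc, mul_comm, ← Complex.ofReal_mul, e2]
  have hvi : Integrable v := by
    have hvn : ∀ x, ‖v x‖ ≤ ‖h x‖ ^ (r * r'⁻¹) := fun x => by
      rw [hv, norm_mul, Complex.norm_real, Real.norm_of_nonneg (by positivity),
        Real.rpow_mul (norm_nonneg _)]
      exact mul_le_of_le_one_left (by positivity) (hunit _)
    refine (h.integrable_norm_rpow (p := r * r'⁻¹) (by positivity)).mono' ?_ (ae_of_all _ hvn)
    have : Measurable fun x => (starRingEnd ℂ) (h x) := Complex.continuous_conj.measurable.comp hhm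
    exact Measurable.aestronglyMeasurable (by fun_prop)
  simp only [e1]
  rw [integral_prod_fourierInv_sub hM f.integrable hvi]
  simp only [← hh, hvh]
  rw [integral_complex_ofReal, Complex.norm_real, Real.norm_of_nonneg (by positivity)]

end MultiplierBounds

/-! ### The localized flow on Schwartz functions and on `L^{r'}` -/

section Flow

open Set Filter Topology Complex FourierTransform

variable {d : ℕ}

/-- The symbol of `e^{is⟨∇⟩} P_k` in Mathlib's normalization. -/
noncomputable def flowSymbol (φ : EuclideanSpace ℝ (Fin d) → ℝ) (s : ℝ) (k : Fin d → ℤ)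
    (η : EuclideanSpace ℝ (Fin d)) : ℂ :=
  (φ ((2 * Real.pi) • η - latticePoint k) : ℂ) * kleinGordonSymbol s ((2 * Real.pi) • η)

theorem IsUnitCubeCutoff.hasTemperateGrowth_flowSymbol {φ : EuclideanSpace ℝ (Fin d) → ℝ}
    (hφ : IsUnitCubeCutoff φ) (s : ℝ) (k : Fin d → ℤ) :
    (flowSymbol φ s k).HasTemperateGrowth :=
  (hφ.hasTemperateGrowth k).mul (hasTemperateGrowth_kleinGordonSymbol s)

theorem kleinGordonFlow_cubeProjection {φ : EuclideanSpace ℝ (Fin d) → ℝ}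
    (hφ : IsUnitCubeCutoff φ) (s : ℝ) (k : Fin d → ℤ) (T : 𝓢'(EuclideanSpace ℝ (Fin d), ℂ)) :
    kleinGordonFlow d s (cubeProjection φ k T) =
      TemperedDistribution.fourierMultiplierCLM ℂ (flowSymbol φ s k) T :=
  TemperedDistribution.fourierMultiplierCLM_fourierMultiplierCLM_apply (hφ.hasTemperateGrowth k)
    (hasTemperateGrowth_kleinGordonSymbol s) T

theorem IsUnitCubeCutoff.continuous_flowSymbol {φ : EuclideanSpace ℝ (Fin d) → ℝ}
    (hφ : IsUnitCubeCutoff φ) (s : ℝ) (k : Fin d → ℤ) : Continuous (flowSymbol φ s k) := by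
  have := hφ.contDiff.continuous
  unfold flowSymbol
  fun_prop

theorem norm_flowSymbol {φ : EuclideanSpace ℝ (Fin d) → ℝ}
    (hφ : IsUnitCubeCutoff φ) (s : ℝ) (k : Fin d → ℤ) (η : EuclideanSpace ℝ (Fin d)) :
    ‖flowSymbol φ s k η‖ = φ ((2 * Real.pi) • η - latticePoint k) := by
  rw [flowSymbol, norm_mul, norm_kleinGordonSymbol, mul_one, Complex.norm_real,
    Real.norm_of_nonneg (hφ.nonneg _)]

theorem IsUnitCubeCutoff.integrable_flowSymbol {φ : EuclideanSpace ℝ (Fin d) → ℝ}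
    (hφ : IsUnitCubeCutoff φ) (s : ℝ) (k : Fin d → ℤ) : Integrable (flowSymbol φ s k) := by
  have h := (hφ.integrable.comp_sub_right (latticePoint k)).comp_smul Real.two_pi_pos.ne'
  exact h.mono' (hφ.continuous_flowSymbol s k).aestronglyMeasurable
    (ae_of_all _ fun η => (norm_flowSymbol hφ s k η).le)

/-- The substitution `ξ = 2πη` produces the factor `(2π)^{-d}`, which is at most 1 and is dropped.
-/
theorem norm_fourierInv_flowSymbol_le (φ : EuclideanSpace ℝ (Fin d) → ℝ) (s : ℝ) (k : Fin d → ℤ)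
    (x : EuclideanSpace ℝ (Fin d)) : ‖𝓕⁻ (flowSymbol φ s k) x‖ ≤ ‖cubeKernel φ s k x‖ := by
  have h := Measure.integral_comp_smul (volume : Measure (EuclideanSpace ℝ (Fin d)))
    (fun ξ => cexp (I * (inner ℝ x ξ : ℝ)) * (kleinGordonSymbol s ξ * φ (ξ - latticePoint k)))
    (2 * Real.pi)
  have h1 : 𝓕⁻ (flowSymbol φ s k) x = ∫ η, cexp (I * (inner ℝ x ((2 * Real.pi) • η) : ℝ)) *
      (kleinGordonSymbol s ((2 * Real.pi) • η) * φ ((2 * Real.pi) • η - latticePoint k)) := by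
    rw [Real.fourierInv_eq']
    congr 1
    ext η
    rw [smul_eq_mul, flowSymbol, inner_smul_right, real_inner_comm x η, mul_comm I,
      mul_comm (kleinGordonSymbol _ _)]
  rw [h1, h, norm_smul]
  refine mul_le_of_le_one_left (norm_nonneg _) ?_
  rw [Real.norm_eq_abs, abs_abs, abs_inv]
  refine inv_le_one_of_one_le₀ ?_
  rw [abs_of_pos (by positivity)]
  exact one_le_pow₀ (by linarith [Real.pi_gt_three])

theorem fourierMultiplierCLM_flowSymbol_apply {φ : EuclideanSpace ℝ (Fin d) → ℝ}
    (hφ : IsUnitCubeCutoff φ) (s : ℝ) (k : Fin d → ℤ) (f : 𝓢(EuclideanSpace ℝ (Fin d), ℂ))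
    (x : EuclideanSpace ℝ (Fin d)) :
    SchwartzMap.fourierMultiplierCLM ℂ (flowSymbol φ s k) f x =
      𝓕⁻ (fun η => flowSymbol φ s k η * 𝓕 (f : EuclideanSpace ℝ (Fin d) → ℂ) η) x := by
  have h : (⇑(SchwartzMap.smulLeftCLM ℂ (flowSymbol φ s k) (𝓕 f)) :
      EuclideanSpace ℝ (Fin d) → ℂ) =
      fun η => flowSymbol φ s k η * 𝓕 (f : EuclideanSpace ℝ (Fin d) → ℂ) η := by
    ext η
    rw [SchwartzMap.smulLeftCLM_apply_apply (hφ.hasTemperateGrowth_flowSymbol s k),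
      SchwartzMap.fourier_coe, smul_eq_mul]
  rw [SchwartzMap.fourierMultiplierCLM_apply, SchwartzMap.fourierInv_coe, h]

/-- The bound on Schwartz functions. -/
theorem norm_toLp_fourierMultiplierCLM_flowSymbol_le {φ : EuclideanSpace ℝ (Fin d) → ℝ}
    (hφ : IsUnitCubeCutoff φ) (s : ℝ) (k : Fin d → ℤ) {D : ℝ}
    (hD : ∀ x, ‖cubeKernel φ s k x‖ ≤ D) {r r' : ℝ≥0∞} (hr : 2 ≤ r) (hrr' : r.HolderConjugate r')
    (f : 𝓢(EuclideanSpace ℝ (Fin d), ℂ)) :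
    ‖(SchwartzMap.fourierMultiplierCLM ℂ (flowSymbol φ s k) f).toLp r volume‖ ≤
      D ^ (1 - 2 * (r⁻¹).toReal) * ‖f.toLp r' volume‖ := by
  have hD0 : 0 ≤ D := (norm_nonneg _).trans (hD 0)
  have hD' : ∀ x, ‖𝓕⁻ (flowSymbol φ s k) x‖ ≤ D := fun x =>
    (norm_fourierInv_flowSymbol_le φ s k x).trans (hD x)
  have hMi := hφ.integrable_flowSymbol s k
  have happ := fourierMultiplierCLM_flowSymbol_apply hφ s k f
  set h := SchwartzMap.fourierMultiplierCLM ℂ (flowSymbol φ s k) f with hh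
  rw [SchwartzMap.norm_toLp, SchwartzMap.norm_toLp]
  -- At `r = ∞` the supremum bound on the kernel gives the estimate directly; integral formulas for
  -- the norms need finite exponents.
  by_cases htop : r = ⊤
  · subst htop
    have hr'1 : r' = 1 := ENNReal.HolderConjugate.eq_top_iff_eq_one ⊤ r' |>.1 rfl
    subst hr'1
    have h1 : (eLpNorm (f : EuclideanSpace ℝ (Fin d) → ℂ) 1 volume).toReal = ∫ y, ‖f y‖ := by
      rw [eLpNorm_one_eq_lintegral_enorm, integral_norm_eq_lintegral_enorm
        f.integrable.aestronglyMeasurable]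
    have hbd : ∀ x, ‖h x‖ ≤ D * ∫ y, ‖f y‖ := by
      intro x
      rw [happ, ← integral_fourierInv_sub_mul hMi f.integrable, ← integral_const_mul]
      refine norm_integral_le_of_norm_le (f.integrable.norm.const_mul D) (ae_of_all _ fun y => ?_)
      rw [norm_mul]
      gcongr
      exact hD' _
    have h2 : (1 : ℝ) - 2 * ((⊤ : ℝ≥0∞)⁻¹).toReal = 1 := by simp
    rw [h1, h2, Real.rpow_one]
    refine ENNReal.toReal_le_of_le_ofReal (by positivity) ?_
    rw [eLpNorm_exponent_top]
    refine (eLpNormEssSup_le_of_ae_bound (ae_of_all _ hbd))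
  · have hr0 : r ≠ 0 := (two_pos.trans_le hr).ne'
    have hr2 : 2 ≤ r.toReal := by
      have := ENNReal.toReal_mono htop hr
      simpa using this
    have hconj : r.toReal.HolderConjugate r'.toReal :=
      ENNReal.HolderConjugate.toReal (by linarith)
    have hr'0 : r' ≠ 0 := fun h0 => by
      have := hconj.symm.pos
      simp [h0] at this
    have hr't : r' ≠ ⊤ := fun h0 => by
      have := hconj.symm.pos
      simp [h0] at this
    rw [(h.memLp r volume).eLpNorm_eq_integral_rpow_norm hr0 htop,
      (f.memLp r' volume).eLpNorm_eq_integral_rpow_norm hr'0 hr't,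
      ENNReal.toReal_ofReal (by positivity), ENNReal.toReal_ofReal (by positivity),
      ENNReal.toReal_inv, ← div_eq_mul_inv]
    exact integral_norm_rpow_multiplier_le hMi
      (fun η => (norm_flowSymbol hφ s k η).le.trans (hφ.le_one _)) hD' happ hr2 hconj

/-- The bound on `L^{r'}`, by density of the Schwartz functions. -/
theorem exists_toTemperedDistribution_eq_flow {φ : EuclideanSpace ℝ (Fin d) → ℝ}
    (hφ : IsUnitCubeCutoff φ) (s : ℝ) (k : Fin d → ℤ) {D : ℝ}
    (hD : ∀ x, ‖cubeKernel φ s k x‖ ≤ D) {r r' : ℝ≥0∞} [Fact (1 ≤ r)] [Fact (1 ≤ r')] (hr : 2 ≤ r)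
    (hrr' : r.HolderConjugate r') (f : Lp ℂ r' (volume : Measure (EuclideanSpace ℝ (Fin d)))) :
    ∃ g : Lp ℂ r (volume : Measure (EuclideanSpace ℝ (Fin d))),
      Lp.toTemperedDistribution g =
        kleinGordonFlow d s (cubeProjection φ k (Lp.toTemperedDistribution f)) ∧
      ‖g‖ ≤ D ^ (1 - 2 * (r⁻¹).toReal) * ‖f‖ := by
  -- Schwartz functions are dense in `L^{r'}` only for finite `r'`; here `r' = ∞` would force `r =
  -- 1`.
  have hr't : r' ≠ ⊤ := by
    rintro rfl
    have h1 : r = 1 := ENNReal.HolderConjugate.eq_top_iff_eq_one ⊤ r |>.1 rfl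
    rw [h1] at hr
    exact absurd hr (by norm_num)
  set N : ℝ := D ^ (1 - 2 * (r⁻¹).toReal) with hN
  set e := SchwartzMap.toLpCLM ℂ (E := EuclideanSpace ℝ (Fin d)) ℂ r' volume with he
  set T : 𝓢(EuclideanSpace ℝ (Fin d), ℂ) →L[ℂ]
      Lp ℂ r (volume : Measure (EuclideanSpace ℝ (Fin d))) :=
    SchwartzMap.toLpCLM ℂ (E := EuclideanSpace ℝ (Fin d)) ℂ r volume ∘L
      SchwartzMap.fourierMultiplierCLM ℂ (flowSymbol φ s k) with hT
  have hdense : DenseRange e := SchwartzMap.denseRange_toLpCLM hr't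
  have hnorm : ∀ ψ, ‖T.toLinearMap ψ‖ ≤ N * ‖e.toLinearMap ψ‖ := fun ψ =>
    norm_toLp_fourierMultiplierCLM_flowSymbol_le hφ s k hD hr hrr' ψ
  refine ⟨T.toLinearMap.extendOfNorm e.toLinearMap f, ?_,
    LinearMap.norm_extendOfNorm_apply_le hdense N hnorm f⟩
  rw [kleinGordonFlow_cubeProjection hφ]
  -- Both sides are continuous from `L^{r'}` to tempered distributions, so agreement on Schwartz
  -- functions suffices.
  refine hdense.induction_on (p := fun f => Lp.toTemperedDistribution
    (T.toLinearMap.extendOfNorm e.toLinearMap f) = TemperedDistribution.fourierMultiplierCLM ℂ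
      (flowSymbol φ s k) (Lp.toTemperedDistribution f)) f ?_ fun ψ => ?_
  · refine isClosed_eq ?_ ?_
    · exact (Lp.toTemperedDistributionCLM ℂ volume r ∘L
        T.toLinearMap.extendOfNorm e.toLinearMap).continuous
    · exact (TemperedDistribution.fourierMultiplierCLM ℂ (flowSymbol φ s k) ∘L
        Lp.toTemperedDistributionCLM ℂ volume r').continuous
  · have h1 : T.toLinearMap.extendOfNorm e.toLinearMap (e ψ) = T ψ :=
      LinearMap.extendOfNorm_eq hdense ⟨N, hnorm⟩ ψ
    rw [h1]
    have h2 : Lp.toTemperedDistribution (e ψ) =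
        SchwartzMap.toTemperedDistributionCLM _ ℂ volume ψ :=
      Lp.toTemperedDistribution_toLp_eq ψ
    have h3 : Lp.toTemperedDistribution (T ψ) = SchwartzMap.toTemperedDistributionCLM _ ℂ volume
        (SchwartzMap.fourierMultiplierCLM ℂ (flowSymbol φ s k) ψ) :=
      Lp.toTemperedDistribution_toLp_eq _
    rw [h2, h3, TemperedDistribution.fourierMultiplierCLM_toTemperedDistributionCLM_eq
      (hφ.hasTemperateGrowth_flowSymbol s k)]

end Flow

theorem mainTheorem9 (d : ℕ) (hd : 1 ≤ d) (φ : EuclideanSpace ℝ (Fin d) → ℝ)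
    (hφ : IsUnitCubeCutoff φ) :
    ∃ C : ℝ≥0, ∀ (r r' : ℝ≥0∞) [Fact (1 ≤ r)] [Fact (1 ≤ r')], 2 ≤ r → r.HolderConjugate r' →
      ∀ (σ : ℝ), σ = 1 ∨ σ = -1 → ∀ (t : ℝ) (k : Fin d → ℤ)
        (f : Lp ℂ r' (volume : Measure (EuclideanSpace ℝ (Fin d)))),
        ∃ g : Lp ℂ r (volume : Measure (EuclideanSpace ℝ (Fin d))),
          Lp.toTemperedDistribution g =
            kleinGordonFlow d (σ * t) (cubeProjection φ k (Lp.toTemperedDistribution f)) ∧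
          ‖g‖ₑ ≤ C * decayFactor k t ^ (1 - 2 * (r⁻¹).toReal) * ‖f‖ₑ := by
  obtain ⟨C, hC1, hC⟩ := exists_enorm_cubeKernel_le hd hφ
  refine ⟨C.toNNReal, fun r r' _ _ hr hrr' σ hσ t k f => ?_⟩
  have hC0 : 0 ≤ C := zero_le_one.trans hC1
  have hσt : |σ * t| = |t| := by
    rcases hσ with rfl | rfl <;> simp
  have hδ : decayFactor k t ≠ ⊤ := ne_top_of_le_ne_top ENNReal.one_ne_top (min_le_left _ _)
  set δ : ℝ := (decayFactor k t).toReal with hδ'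
  have hδ0 : 0 ≤ δ := ENNReal.toReal_nonneg
  have hker : ∀ x, ‖cubeKernel φ (σ * t) k x‖ ≤ C * δ := by
    intro x
    have h := ENNReal.toReal_mono (ENNReal.mul_ne_top ENNReal.ofReal_ne_top hδ) (hC _ t k x hσt)
    rwa [toReal_enorm, ENNReal.toReal_mul, ENNReal.toReal_ofReal hC0] at h
  obtain ⟨g, hg, hgn⟩ := exists_toTemperedDistribution_eq_flow hφ (σ * t) k hker hr hrr' f
  refine ⟨g, hg, ?_⟩
  set θ : ℝ := 1 - 2 * (r⁻¹).toReal with hθ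
  have hrinv : (r⁻¹).toReal ≤ 1 / 2 := by
    have h := ENNReal.toReal_mono (by simp) (ENNReal.inv_le_inv.2 hr)
    simpa using h
  have hθ0 : 0 ≤ θ := by linarith
  have hθ1 : θ ≤ 1 := by linarith [ENNReal.toReal_nonneg (a := r⁻¹)]
  have hle : ‖g‖ ≤ C * δ ^ θ * ‖f‖ := by
    refine hgn.trans ?_
    gcongr
    rw [Real.mul_rpow hC0 hδ0]
    gcongr
    -- `C ≥ 1` and `θ ≤ 1` give `C^θ ≤ C`, which makes the constant independent of `r`.
    exact (Real.rpow_le_rpow_of_exponent_le hC1 hθ1).trans_eq (Real.rpow_one C)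
  rw [← ofReal_norm, ← ofReal_norm]
  refine (ENNReal.ofReal_le_ofReal hle).trans_eq ?_
  rw [ENNReal.ofReal_mul (by positivity), ENNReal.ofReal_mul hC0,
    ← ENNReal.ofReal_rpow_of_nonneg hδ0 hθ0, ENNReal.ofReal_toReal hδ]
  rfl
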